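/- Let $\{\mu_j\}_{j\in\mathbb N}$, $\{\gamma_j\}_{j\in\mathbb N}$, $\{\nu_j\}_{j\in\mathbb N}$ be sequences of real random variables on a common probability space. Each sequence is i.i.d., the three sequences are independent of one another, and their distributions have bounded support. For $n\ge 1$ consider the anisotropic XY chain $$H=H_{[1,n]}=-\sum_{j=1}^{n-1}\mu_j\big[(1+\gamma_j)\sigma^x_j\sigma^x_{j+1}+(1-\gamma_j)\sigma^y_j\sigma^y_{j+1}\big]-\sum_{j=1}^n\nu_j\sigma^z_j$$ on $\mathcal H=\bigotimes_{j=1}^n\mathbb C^2$, where $\sigma_j^x,\sigma_j^y,\sigma_j^z$ are the Pauli matrices acting on the $j$-th factor. Let $M=M_{[1,n]}$ be the $n\times n$ block Jacobi matrix with $2\times2$ blocks $M_{jj}=-\nu_j\sigma^z$, $M_{j,j+1}=\mu_jS(\gamma_j)$, $M_{j+1,j}=\mu_jS(\gamma_j)^T$, where $S(\gamma)=\begin{pmatrix}1&\gamma\\-\gamma&-1\end{pmatrix}$, and with all other blocks equal to $0$. Assume that, for every $n$, the spectrum of $H_{[1,n]}$ is almost surely simple, and that $M$ has localized eigencorrelators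 with $F(r)=C_0/(1+r)^\beta$ for some $C_0>0$ and some $\beta>4$, that is, $$\mathbb E\Big(\sup_{|g|\le1}\|g(M)_{jk}\|\Big)\le\frac{C_0}{(1+|j-k|)^\beta}\qquad\text{for all } n\in\mathbb N \text{ and } 1\le j,k\le n,$$ where the supremum is over all Borel functions $g:\mathbb R\to\mathbb C$ with $|g|\le1$ pointwise, $g(M)_{jk}$ denotes the $2\times2$ block of $g(M)$ at position $(j,k)$, and $\|\cdot\|$ is the operator norm induced by the Euclidean norm on $\mathbb C^2$. For $\alpha\in\{0,1\}^n$ let $e_\alpha=e_{\alpha_1}\otimes\cdots\otimes e_{\alpha_n}$ with $e_0=\begin{pmatrix}0\\1\end{pmatrix}$ and $e_1=\begin{pmatrix}1\\0\end{pmatrix}$. For $1\le a\le b\le n$ and a density matrix $\rho$ on $\mathcal H$ let $\mathcal E(\rho)=-\operatorname{Tr}\rho^1\log\rho^1$, where $\rho^1$ is the partial trace of $\rho$ over the sites outside $[a,b]$. Then there exists $C<\infty$ such that $$\mathbb E\Big(\sup_{t\in\mathbb R,\ \alpha\in\{0,1\}^n}\mathcal E\big(e^{-itH}|e_\alpha\rangle\langle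 e_\alpha|e^{itH}\big)\Big)\le C$$ for all $n$, $a$ and $b$ with $1\le a\le b\le n$. -/

import Mathlib

open MeasureTheory ProbabilityTheory Matrix
open scoped ENNReal

noncomputable section

namespace XYChain

/-! ### The spin chain

The sites are `Fin n` (site `j` here is site `j + 1` of `{1, …, n}`). The Hilbert space `⨂_{j ∈ S} ℂ²`
over a finite set `S` of sites is written in coordinates with respect to the tensor products of the
standard basis of `ℂ²`, that is, as `(S → Fin 2) → ℂ`; operators are matrices over `S → Fin 2`. -/

/-- The Pauli matrix `σ^x`. -/
def pauliX : Matrix (Fin 2) (Fin 2) ℂ := !![0, 1; 1, 0]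

/-- The Pauli matrix `σ^y`. -/
def pauliY : Matrix (Fin 2) (Fin 2) ℂ := !![0, -Complex.I; Complex.I, 0]

/-- The Pauli matrix `σ^z`. -/
def pauliZ : Matrix (Fin 2) (Fin 2) ℂ := !![1, 0; 0, -1]

/-- The tensor product `⨂_j A_j` of one-site operators (Kronecker product of matrices). -/
def tensorOp {n : ℕ} (A : Fin n → Matrix (Fin 2) (Fin 2) ℂ) :
    Matrix (Fin n → Fin 2) (Fin n → Fin 2) ℂ :=
  Matrix.of fun x y => ∏ j, A j (x j) (y j)

/-- The operator `1 ⊗ … ⊗ A ⊗ … ⊗ 1` with `A` acting on the `j`-th tensor factor. -/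
def siteOp {n : ℕ} (j : Fin n) (A : Matrix (Fin 2) (Fin 2) ℂ) :
    Matrix (Fin n → Fin 2) (Fin n → Fin 2) ℂ :=
  tensorOp (Function.update (fun _ => 1) j A)

/-- The anisotropic XY Hamiltonian on `n` sites with interaction strengths `μ j`, anisotropies `γ j`
and field strengths `ν j`. The double sum runs over the pairs of neighbours `(j, j + 1)`. -/
def hamiltonian (n : ℕ) (μ γ ν : ℕ → ℝ) : Matrix (Fin n → Fin 2) (Fin n → Fin 2) ℂ :=
  - (∑ j : Fin n, ∑ k : Fin n,
      if (j : ℕ) + 1 = k then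
        (μ j : ℂ) • ((1 + (γ j : ℂ)) • (siteOp j pauliX * siteOp k pauliX)
          + (1 - (γ j : ℂ)) • (siteOp j pauliY * siteOp k pauliY))
      else 0)
  - ∑ j : Fin n, (ν j : ℂ) • siteOp j pauliZ

/-- All eigenvalues of the matrix `A` have multiplicity one. -/
def HasSimpleSpectrum {ι : Type*} [Fintype ι] [DecidableEq ι] (A : Matrix ι ι ℂ) : Prop :=
  ∀ E : ℂ, Module.finrank ℂ (Module.End.eigenspace (Matrix.toLin' A) E) ≤ 1

/-! ### The effective one-particle Hamiltonian and its functional calculus -/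

/-- The off-diagonal building block `S(γ)`. -/
def blockS (γ : ℝ) : Matrix (Fin 2) (Fin 2) ℂ := !![1, (γ : ℂ); -(γ : ℂ), -1]

/-- The effective one-particle Hamiltonian `M`, an `n × n` block Jacobi matrix with `2 × 2` blocks:
`-ν_j σ^z` on the diagonal, `μ_j S(γ_j)` right above it, and `μ_j S(γ_j)ᵀ` right below it. -/
def effHam (n : ℕ) (μ γ ν : ℕ → ℝ) : Matrix (Fin n × Fin 2) (Fin n × Fin 2) ℂ :=
  Matrix.of fun p q =>
    if p.1 = q.1 then -(ν p.1 : ℂ) * pauliZ p.2 q.2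
    else if (p.1 : ℕ) + 1 = q.1 then (μ p.1 : ℂ) * blockS (γ p.1) p.2 q.2
    else if (q.1 : ℕ) + 1 = p.1 then (μ q.1 : ℂ) * (blockS (γ q.1))ᵀ p.2 q.2
    else 0

theorem effHam_isHermitian (n : ℕ) (μ γ ν : ℕ → ℝ) : (effHam n μ γ ν).IsHermitian := by
  ext ⟨j, s⟩ ⟨k, s'⟩
  simp only [conjTranspose_apply, effHam, of_apply]
  by_cases h : j = k
  · subst h
    fin_cases s <;> fin_cases s' <;> simp [pauliZ]
  · have h' : ¬ k = j := fun e => h e.symm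
    by_cases h1 : (j : ℕ) + 1 = k
    · have h2 : ¬ (k : ℕ) + 1 = j := by omega
      simp only [h, h', h1, h2, if_true, if_false]
      fin_cases s <;> fin_cases s' <;> simp [blockS]
    · by_cases h2 : (k : ℕ) + 1 = j
      · simp only [h, h', h1, h2, if_true, if_false]
        fin_cases s <;> fin_cases s' <;> simp [blockS]
      · simp [h, h', h1, h2]

/-- The functional calculus `g(A) = U diag(g(λ_i)) U*` of a hermitian matrix `A = U diag(λ_i) U*`. -/
def hermitianFun {ι : Type*} [Fintype ι] [DecidableEq ι] {A : Matrix ι ι ℂ} (hA : A.IsHermitian)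
    (g : ℝ → ℂ) : Matrix ι ι ℂ :=
  (hA.eigenvectorUnitary : Matrix ι ι ℂ) * Matrix.diagonal (fun i => g (hA.eigenvalues i)) *
    star (hA.eigenvectorUnitary : Matrix ι ι ℂ)

/-- The `2 × 2` block at position `(j, k)`. -/
def block {n : ℕ} (B : Matrix (Fin n × Fin 2) (Fin n × Fin 2) ℂ) (j k : Fin n) :
    Matrix (Fin 2) (Fin 2) ℂ :=
  Matrix.of fun s s' => B (j, s) (k, s')

/-- The eigencorrelator `sup_{|g| ≤ 1} ‖g(M)_{jk}‖`, where `g` ranges over the Borel functions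
`ℝ → ℂ` of modulus at most `1` and `‖·‖` is the operator norm on `ℂ²` with its Euclidean norm. -/
def eigencorrelator (n : ℕ) (μ γ ν : ℕ → ℝ) (j k : Fin n) : ℝ≥0∞ :=
  ⨆ g : {g : ℝ → ℂ // Measurable g ∧ ∀ x, ‖g x‖ ≤ 1},
    ENNReal.ofReal ‖Matrix.toEuclideanCLM (n := Fin 2) (𝕜 := ℂ)
      (block (hermitianFun (effHam_isHermitian n μ γ ν) g.1) j k)‖

/-! ### Entanglement -/

/-- The one-site vectors `e_0 = |↓⟩ = (0, 1)ᵀ` and `e_1 = |↑⟩ = (1, 0)ᵀ`. -/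
def spinVec : Fin 2 → Fin 2 → ℂ := ![![0, 1], ![1, 0]]

/-- The up-down spin configuration `e_α = e_{α_1} ⊗ … ⊗ e_{α_n}`. -/
def upDown {n : ℕ} (α : Fin n → Fin 2) : (Fin n → Fin 2) → ℂ :=
  fun x => ∏ j, spinVec (α j) (x j)

/-- The rank-one operator `|ψ⟩⟨ψ|`. -/
def pureState {ι : Type*} (ψ : ι → ℂ) : Matrix ι ι ℂ := Matrix.vecMulVec ψ (star ψ)

/-- The Schrödinger evolution `e^{-itH} ρ e^{itH}`. -/
def evolve {ι : Type*} [Fintype ι] [DecidableEq ι] (H : Matrix ι ι ℂ) (t : ℝ) (ρ : Matrix ι ι ℂ) :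
    Matrix ι ι ℂ :=
  NormedSpace.exp ((-(Complex.I * (t : ℂ))) • H) * ρ * NormedSpace.exp ((Complex.I * (t : ℂ)) • H)

/-- The configuration on all sites that is `x` on the sites in `S` and `z` on the other sites. -/
def glue {n : ℕ} (S : Finset (Fin n)) (x : {j // j ∈ S} → Fin 2) (z : {j // j ∉ S} → Fin 2) :
    Fin n → Fin 2 :=
  fun j => if h : j ∈ S then x ⟨j, h⟩ else z ⟨j, h⟩

/-- The partial trace over the sites outside `S`. -/
def reducedState {n : ℕ} (S : Finset (Fin n)) (ρ : Matrix (Fin n → Fin 2) (Fin n → Fin 2) ℂ) :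
    Matrix ({j // j ∈ S} → Fin 2) ({j // j ∈ S} → Fin 2) ℂ :=
  Matrix.of fun x y => ∑ z : {j // j ∉ S} → Fin 2, ρ (glue S x z) (glue S y z)

/-- The von Neumann entropy `-Tr ρ log ρ` of a density matrix (natural logarithm, `0 log 0 = 0`). -/
def entropy {ι : Type*} [Fintype ι] [DecidableEq ι] (ρ : Matrix ι ι ℂ) : ℝ :=
  (Matrix.trace (cfc Real.negMulLog ρ)).re

/-- The bipartite entanglement of the state `ρ` with respect to the sites in `S` and the others. -/
def entanglement {n : ℕ} (S : Finset (Fin n)) (ρ : Matrix (Fin n → Fin 2) (Fin n → Fin 2) ℂ) : ℝ :=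
  entropy (reducedState S ρ)

/-! ### The random model -/

variable {Ω : Type*} [MeasurableSpace Ω]

/-- The random parameters: three sequences of real random variables, each of them i.i.d., independent
from one another (so all variables are jointly independent), with laws of bounded support. -/
structure IsRandomModel (P : Measure Ω) (μ γ ν : ℕ → Ω → ℝ) : Prop where
  measurable_μ : ∀ j, Measurable (μ j)
  measurable_γ : ∀ j, Measurable (γ j)
  measurable_ν : ∀ j, Measurable (ν j)
  indep : iIndepFun (fun p : Fin 3 × ℕ => (![μ, γ, ν] : Fin 3 → ℕ → Ω → ℝ) p.1 p.2) P
  ident_μ : ∀ j, IdentDistrib (μ j) (μ 0) P P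
  ident_γ : ∀ j, IdentDistrib (γ j) (γ 0) P P
  ident_ν : ∀ j, IdentDistrib (ν j) (ν 0) P P
  bounded : ∃ R : ℝ, ∀ j, ∀ᵐ ω ∂P, |μ j ω| ≤ R ∧ |γ j ω| ≤ R ∧ |ν j ω| ≤ R

/-- For every `n`, the Hamiltonian on `n` sites almost surely has simple spectrum. -/
def AlmostSurelySimple (P : Measure Ω) (μ γ ν : ℕ → Ω → ℝ) : Prop :=
  ∀ n : ℕ, ∀ᵐ ω ∂P,
    HasSimpleSpectrum (hamiltonian n (fun j => μ j ω) (fun j => γ j ω) (fun j => ν j ω))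

/-- Eigencorrelator localization with decay function `F`: a non-increasing `F : [0, ∞) → (0, ∞)` with
`𝔼 sup_{|g| ≤ 1} ‖g(M)_{jk}‖ ≤ F(|j - k|)` uniformly in `n` and `j, k`. -/
structure EigencorrelatorLocalization (P : Measure Ω) (μ γ ν : ℕ → Ω → ℝ) (F : ℝ → ℝ) : Prop where
  antitone : AntitoneOn F (Set.Ici 0)
  pos : ∀ r, 0 ≤ r → 0 < F r
  bound : ∀ (n : ℕ) (j k : Fin n),
    ∫⁻ ω, eigencorrelator n (fun i => μ i ω) (fun i => γ i ω) (fun i => ν i ω) j k ∂P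
      ≤ ENNReal.ofReal (F |(j : ℝ) - (k : ℝ)|)

end XYChain

end

noncomputable section

namespace XYChain

/-! ### Tensor products of one-site operators over a finite linear order of sites -/

/-- The tensor product of one-site operators over any finite set of sites. -/
def tens {ι : Type*} [Fintype ι] (A : ι → Matrix (Fin 2) (Fin 2) ℂ) :
    Matrix (ι → Fin 2) (ι → Fin 2) ℂ :=
  Matrix.of fun x y => ∏ j, A j (x j) (y j)

section tens

variable {ι : Type*} [Fintype ι]

theorem tens_mul [DecidableEq ι] (A B : ι → Matrix (Fin 2) (Fin 2) ℂ) :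
    tens A * tens B = tens fun j => A j * B j := by
  ext x y
  simp only [tens, Matrix.mul_apply, Matrix.of_apply]
  rw [Finset.prod_univ_sum]
  simp [Finset.prod_mul_distrib]

theorem tens_one : tens (fun _ : ι => (1 : Matrix (Fin 2) (Fin 2) ℂ)) = 1 := by
  classical
  ext x y
  simp only [tens, Matrix.of_apply, Matrix.one_apply]
  by_cases h : x = y
  · simp [h]
  · obtain ⟨j, hj⟩ := Function.ne_iff.1 h
    simp only [h, if_false]
    exact Finset.prod_eq_zero (Finset.mem_univ j) (by simp [hj])

theorem tens_conjTranspose (A : ι → Matrix (Fin 2) (Fin 2) ℂ) :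
    (tens A)ᴴ = tens fun j => (A j)ᴴ := by
  ext x y
  simp [tens, Matrix.conjTranspose_apply]

theorem tens_eq_smul (A B : ι → Matrix (Fin 2) (Fin 2) ℂ) (c : ℂ) (j : ι) (hj : A j = c • B j)
    (h : ∀ k, k ≠ j → A k = B k) : tens A = c • tens B := by
  classical
  ext x y
  simp only [tens, Matrix.of_apply, Matrix.smul_apply, smul_eq_mul]
  rw [← Finset.mul_prod_erase _ _ (Finset.mem_univ j),
    ← Finset.mul_prod_erase _ (fun k => B k (x k) (y k)) (Finset.mem_univ j), hj]
  rw [Finset.prod_congr rfl fun k hk => by rw [h k (Finset.ne_of_mem_erase hk)]]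
  simp [mul_assoc]

end tens

/-! ### Majorana operators -/

theorem pauliX_mul_self : pauliX * pauliX = 1 := by
  ext i j; fin_cases i <;> fin_cases j <;> simp [pauliX, Matrix.mul_apply]

theorem pauliY_mul_self : pauliY * pauliY = 1 := by
  ext i j; fin_cases i <;> fin_cases j <;> simp [pauliY, Matrix.mul_apply]

theorem pauliZ_mul_self : pauliZ * pauliZ = 1 := by
  ext i j; fin_cases i <;> fin_cases j <;> simp [pauliZ, Matrix.mul_apply]

/-- The Pauli matrices `σ^x` and `σ^y`. -/
def pauliXY (s : Fin 2) : Matrix (Fin 2) (Fin 2) ℂ := if s = 0 then pauliX else pauliY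

theorem pauliXY_mul_self (s : Fin 2) : pauliXY s * pauliXY s = 1 := by
  fin_cases s <;> simp [pauliXY, pauliX_mul_self, pauliY_mul_self]

theorem pauliXY_mul_pauliZ (s : Fin 2) : pauliXY s * pauliZ = (-1 : ℂ) • (pauliZ * pauliXY s) := by
  fin_cases s <;> ext i j <;> fin_cases i <;> fin_cases j <;>
    simp [pauliXY, pauliX, pauliY, pauliZ, Matrix.mul_apply]

theorem pauliXY_anticomm {s t : Fin 2} (h : s ≠ t) :
    pauliXY s * pauliXY t = (-1 : ℂ) • (pauliXY t * pauliXY s) := by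
  fin_cases s <;> fin_cases t <;> (try exact absurd rfl h) <;>
    ext i j <;> fin_cases i <;> fin_cases j <;> simp [pauliXY, pauliX, pauliY, Matrix.mul_apply]

theorem pauliZ_conjTranspose : pauliZᴴ = pauliZ := by
  ext i j; fin_cases i <;> fin_cases j <;> simp [pauliZ, Matrix.conjTranspose_apply]

theorem pauliXY_conjTranspose (s : Fin 2) : (pauliXY s)ᴴ = pauliXY s := by
  fin_cases s <;> ext i j <;> fin_cases i <;> fin_cases j <;>
    simp [pauliXY, pauliX, pauliY, Matrix.conjTranspose_apply]

section majorana

variable {ι : Type*} [Fintype ι] [LinearOrder ι]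

/-- The tensor factors of the Majorana operators (Jordan–Wigner transformation). -/
def majoranaFactor (p : ι × Fin 2) (k : ι) : Matrix (Fin 2) (Fin 2) ℂ :=
  if k < p.1 then pauliZ else if k = p.1 then pauliXY p.2 else 1

/-- The Majorana operator `σ^z ⊗ … ⊗ σ^z ⊗ σ^{x,y} ⊗ 1 ⊗ … ⊗ 1`. -/
def majorana (p : ι × Fin 2) : Matrix (ι → Fin 2) (ι → Fin 2) ℂ := tens (majoranaFactor p)

theorem majorana_conjTranspose (p : ι × Fin 2) : (majorana p)ᴴ = majorana p := by
  rw [majorana, tens_conjTranspose]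
  congr 1
  funext k
  simp only [majoranaFactor]
  split_ifs <;> simp [pauliZ_conjTranspose, pauliXY_conjTranspose]

theorem majorana_mul (p q : ι × Fin 2) :
    majorana p * majorana q = tens fun k => majoranaFactor p k * majoranaFactor q k :=
  tens_mul _ _

theorem majorana_mul_self (p : ι × Fin 2) : majorana p * majorana p = 1 := by
  rw [majorana_mul, ← tens_one]
  congr 1
  funext k
  simp only [majoranaFactor]
  split_ifs <;> simp [pauliZ_mul_self, pauliXY_mul_self]

theorem majorana_anticomm_of_lt {p q : ι × Fin 2} (h : p.1 < q.1) :
    majorana p * majorana q = (-1 : ℂ) • (majorana q * majorana p) := by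
  rw [majorana_mul, majorana_mul]
  refine tens_eq_smul _ _ _ p.1 ?_ fun k hk => ?_
  · simp [majoranaFactor, h, pauliXY_mul_pauliZ]
  · simp only [majoranaFactor, hk, if_false]
    split_ifs with h1 h2 h3
    · simp
    · exact absurd (h1.trans h) (by simpa using h2)
    all_goals simp

theorem majorana_anticomm {p q : ι × Fin 2} (h : p ≠ q) :
    majorana p * majorana q = (-1 : ℂ) • (majorana q * majorana p) := by
  rcases lt_trichotomy p.1 q.1 with h1 | h1 | h1
  · exact majorana_anticomm_of_lt h1
  · have h2 : p.2 ≠ q.2 := fun e => h (Prod.ext h1 e)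
    rw [majorana_mul, majorana_mul]
    refine tens_eq_smul _ _ _ p.1 ?_ fun k hk => ?_
    · simpa [majoranaFactor, h1] using pauliXY_anticomm h2
    · simp only [majoranaFactor, h1]
      rw [h1] at hk
      simp [hk]
  · rw [majorana_anticomm_of_lt h1]
    simp

theorem majorana_mul_add (p q : ι × Fin 2) :
    majorana p * majorana q + majorana q * majorana p = if p = q then (2 : ℂ) • 1 else 0 := by
  split_ifs with h
  · rw [h, majorana_mul_self, two_smul]
  · rw [majorana_anticomm h]; simp

/-- The field operator `∑ v_p a_p` of a real vector `v`. -/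
def field (v : ι × Fin 2 → ℝ) : Matrix (ι → Fin 2) (ι → Fin 2) ℂ := ∑ p, (v p : ℂ) • majorana p

theorem field_conjTranspose (v : ι × Fin 2 → ℝ) : (field v)ᴴ = field v := by
  simp [field, Matrix.conjTranspose_sum, Matrix.conjTranspose_smul, majorana_conjTranspose]

theorem field_mul (v w : ι × Fin 2 → ℝ) :
    field v * field w = ∑ p, ∑ q, ((v p : ℂ) * w q) • (majorana p * majorana q) := by
  simp only [field, Finset.sum_mul_sum, smul_mul_smul_comm]

theorem field_mul_add (v w : ι × Fin 2 → ℝ) :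
    field v * field w + field w * field v = ((2 * (v ⬝ᵥ w) : ℝ) : ℂ) • 1 := by
  rw [field_mul, field_mul, Finset.sum_comm (s := Finset.univ) (t := Finset.univ)
    (f := fun p q => ((w p : ℂ) * v q) • (majorana p * majorana q)), ← Finset.sum_add_distrib]
  have : ∀ p, ∑ q, ((v p : ℂ) * w q) • (majorana p * majorana q)
      + ∑ q, ((w q : ℂ) * v p) • (majorana q * majorana p)
      = ((v p : ℂ) * w p) • ((2 : ℂ) • (1 : Matrix (ι → Fin 2) (ι → Fin 2) ℂ)) := by
    intro p
    rw [← Finset.sum_add_distrib]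
    have h : ∀ q, ((v p : ℂ) * w q) • (majorana p * majorana q)
        + ((w q : ℂ) * v p) • (majorana q * majorana p)
        = if p = q then ((v p : ℂ) * w q) • ((2 : ℂ) • (1 : Matrix (ι → Fin 2) (ι → Fin 2) ℂ))
          else 0 := by
      intro q
      rw [mul_comm (w q : ℂ), ← smul_add, majorana_mul_add]
      split_ifs <;> simp
    simp [h]
  simp_rw [this]
  rw [← Finset.sum_smul, smul_smul]
  congr 1
  simp [dotProduct, mul_comm]

theorem field_mul_self {v : ι × Fin 2 → ℝ} (hv : v ⬝ᵥ v = 1) : field v * field v = 1 := by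
  have h := field_mul_add v v
  rw [hv, ← two_smul ℂ] at h
  have h2 : (2 : ℂ) ≠ 0 := two_ne_zero
  simpa using (smul_right_injective _ h2 (by simpa using h) : field v * field v = 1)

theorem field_anticomm {v w : ι × Fin 2 → ℝ} (hv : v ⬝ᵥ w = 0) :
    field v * field w = -(field w * field v) := by
  have h := field_mul_add v w
  rw [hv] at h
  simpa using eq_neg_of_add_eq_zero_left (by simpa using h)

end majorana

/-! ### Joint eigenvectors of commuting involutions -/

section joint

variable {d κ : Type*} [Fintype d]

theorem exists_joint_eigenvector [DecidableEq d] [Nonempty d] (Z W : κ → Matrix d d ℂ)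
    (hZ : ∀ k, Z k * Z k = 1) (hZZ : ∀ k l, k ≠ l → Z k * Z l = Z l * Z k)
    (hW : ∀ k, W k * W k = 1) (hWZ : ∀ k, Z k * W k = -(W k * Z k))
    (hWZ' : ∀ k l, k ≠ l → Z l * W k = W k * Z l) (ε : κ → ℂ) (hε : ∀ k, ε k * ε k = 1)
    (T : Finset κ) : ∃ v : d → ℂ, v ≠ 0 ∧ ∀ k ∈ T, Z k *ᵥ v = ε k • v := by
  classical
  induction T using Finset.induction_on with
  | empty => exact ⟨fun _ => 1, fun h => one_ne_zero (congrFun h (Classical.arbitrary d)), by simp⟩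
  | insert k T hk ih =>
    obtain ⟨v, hv, hT⟩ := ih
    have hne : ∀ l ∈ T, k ≠ l := fun l hl e => hk (e ▸ hl)
    by_cases h : v + ε k • (Z k *ᵥ v) = 0
    · refine ⟨W k *ᵥ v, fun h0 => hv ?_, ?_⟩
      · have := congrArg (fun w => W k *ᵥ w) h0
        simpa [Matrix.mulVec_mulVec, hW] using this
      · have hZv : Z k *ᵥ v = -(ε k • v) := by
          have h1 := congrArg (fun w => ε k • w) h
          simp only [smul_add, smul_smul, hε, one_smul, smul_zero] at h1
          exact eq_neg_of_add_eq_zero_right h1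
        intro l hl
        rcases Finset.mem_insert.1 hl with rfl | hl
        · rw [Matrix.mulVec_mulVec, hWZ, Matrix.neg_mulVec, ← Matrix.mulVec_mulVec, hZv,
            Matrix.mulVec_neg, neg_neg, Matrix.mulVec_smul]
        · rw [Matrix.mulVec_mulVec, hWZ' k l (hne l hl), ← Matrix.mulVec_mulVec, hT l hl,
            Matrix.mulVec_smul]
    · refine ⟨_, h, fun l hl => ?_⟩
      rcases Finset.mem_insert.1 hl with rfl | hl
      · rw [Matrix.mulVec_add, Matrix.mulVec_smul, Matrix.mulVec_mulVec, hZ, Matrix.one_mulVec,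
          smul_add, smul_smul, hε, one_smul, add_comm]
      · rw [Matrix.mulVec_add, Matrix.mulVec_smul, Matrix.mulVec_mulVec,
          ← hZZ k l (hne l hl), ← Matrix.mulVec_mulVec, hT l hl, Matrix.mulVec_smul, smul_add,
          smul_comm]

theorem star_dotProduct_mulVec_of_isHermitian {A : Matrix d d ℂ} (hA : Aᴴ = A) (v w : d → ℂ) :
    star v ⬝ᵥ A *ᵥ w = star (A *ᵥ v) ⬝ᵥ w := by
  rw [Matrix.star_mulVec, hA, Matrix.dotProduct_mulVec]

end joint

/-- The eigenvalue `1`, `-1` of `σ^z`. -/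
def spinSign (s : Fin 2) : ℝ := if s = 0 then 1 else -1

theorem spinSign_injective : Function.Injective spinSign := by
  intro s t h
  fin_cases s <;> fin_cases t <;> simp [spinSign] at h ⊢ <;> norm_num at h

theorem spinSign_mul_self (s : Fin 2) : spinSign s * spinSign s = 1 := by
  fin_cases s <;> simp [spinSign]

theorem exists_joint_unitary {κ : Type*} [Fintype κ] [DecidableEq κ]
    (Z W : κ → Matrix (κ → Fin 2) (κ → Fin 2) ℂ) (hZh : ∀ k, (Z k)ᴴ = Z k)
    (hZ : ∀ k, Z k * Z k = 1) (hZZ : ∀ k l, k ≠ l → Z k * Z l = Z l * Z k)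
    (hW : ∀ k, W k * W k = 1) (hWZ : ∀ k, Z k * W k = -(W k * Z k))
    (hWZ' : ∀ k l, k ≠ l → Z l * W k = W k * Z l) :
    ∃ V : Matrix (κ → Fin 2) (κ → Fin 2) ℂ, Vᴴ * V = 1 ∧
      ∀ k, Vᴴ * Z k * V = Matrix.diagonal fun s => (spinSign (s k) : ℂ) := by
  have hex : ∀ s : κ → Fin 2, ∃ v : (κ → Fin 2) → ℂ, star v ⬝ᵥ v = 1 ∧
      ∀ k, Z k *ᵥ v = (spinSign (s k) : ℂ) • v := by
    intro s
    obtain ⟨v, hv, h⟩ := exists_joint_eigenvector Z W hZ hZZ hW hWZ hWZ'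
      (fun k => (spinSign (s k) : ℂ)) (fun k => by exact_mod_cast spinSign_mul_self _) Finset.univ
    have hpos : 0 < ∑ x, ‖v x‖ ^ 2 := by
      obtain ⟨x, hx⟩ := Function.ne_iff.1 hv
      exact Finset.sum_pos' (fun _ _ => by positivity)
        ⟨x, Finset.mem_univ x, by have : 0 < ‖v x‖ := norm_pos_iff.2 hx
                                  positivity⟩
    have hdot : star v ⬝ᵥ v = ((∑ x, ‖v x‖ ^ 2 : ℝ) : ℂ) := by
      simp [dotProduct, Complex.conj_mul']
    set r := ∑ x, ‖v x‖ ^ 2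
    refine ⟨(((Real.sqrt r)⁻¹ : ℝ) : ℂ) • v, ?_, fun k => ?_⟩
    · rw [star_smul, smul_dotProduct, dotProduct_smul, hdot]
      simp only [RCLike.star_def, Complex.conj_ofReal, smul_eq_mul]
      norm_cast
      rw [← mul_assoc, ← mul_inv, Real.mul_self_sqrt hpos.le, inv_mul_cancel₀ hpos.ne']
    · rw [Matrix.mulVec_smul, h k (Finset.mem_univ k), smul_comm]
  choose v hv1 hv using hex
  have horth : ∀ s t, star (v s) ⬝ᵥ v t = if s = t then 1 else 0 := by
    intro s t
    split_ifs with h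
    · rw [← h, hv1]
    · obtain ⟨k, hk⟩ := Function.ne_iff.1 h
      have h1 := star_dotProduct_mulVec_of_isHermitian (hZh k) (v s) (v t)
      rw [hv, hv, star_smul, dotProduct_smul, smul_dotProduct] at h1
      simp only [RCLike.star_def, Complex.conj_ofReal, smul_eq_mul] at h1
      by_contra h0
      exact hk (spinSign_injective (by exact_mod_cast (mul_right_cancel₀ h0 h1).symm))
  refine ⟨Matrix.of fun x s => v s x, ?_, fun k => ?_⟩
  · ext s t
    simpa [Matrix.mul_apply, dotProduct, Matrix.one_apply] using horth s t
  · ext s t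
    rw [Matrix.mul_assoc]
    change star (v s) ⬝ᵥ (Z k *ᵥ v t) = _
    rw [hv, dotProduct_smul, horth, Matrix.diagonal_apply]
    split_ifs with h <;> simp [h]

/-! ### Gibbs' inequality -/

section gibbs

open scoped ComplexOrder

variable {d : Type*} [Fintype d] [DecidableEq d]

theorem entropy_eq_sum {ρ : Matrix d d ℂ} (hρ : ρ.IsHermitian) :
    entropy ρ = ∑ i, Real.negMulLog (hρ.eigenvalues i) := by
  rw [entropy, hρ.cfc_eq, Matrix.IsHermitian.cfc]
  simp only [Unitary.conjStarAlgAut_apply]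
  rw [Matrix.trace_mul_cycle, Unitary.coe_star_mul_self, one_mul, Matrix.trace_diagonal]
  simp

theorem sub_le_mul_log_sub_mul_log {x y : ℝ} (hx : 0 ≤ x) (hy : 0 < y) :
    x - y ≤ x * Real.log x - x * Real.log y := by
  rcases hx.eq_or_lt with rfl | hx
  · simp [hy.le]
  · have h := Real.log_le_sub_one_of_pos (div_pos hy hx)
    rw [Real.log_div hy.ne' hx.ne'] at h
    have h2 := mul_le_mul_of_nonneg_left h hx.le
    have h3 : x * (y / x - 1) = y - x := by field_simp
    nlinarith

theorem entropy_le_neg_sum_mul_log {ρ : Matrix d d ℂ} (hρ : ρ.PosSemidef) (htr : ρ.trace = 1)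
    {V : Matrix d d ℂ} (hV : Vᴴ * V = 1) {q : d → ℝ} (hq : ∀ s, 0 < q s) (hq1 : ∑ s, q s = 1) :
    entropy ρ ≤ -∑ s, ((Vᴴ * ρ * V) s s).re * Real.log (q s) := by
  have hH := hρ.isHermitian
  set U : Matrix d d ℂ := (hH.eigenvectorUnitary : Matrix d d ℂ)
  set r := hH.eigenvalues
  have hr : ∀ i, 0 ≤ r i := hρ.eigenvalues_nonneg
  have hU : Uᴴ * U = 1 := Unitary.coe_star_mul_self _
  have hU' : U * Uᴴ = 1 := mul_eq_one_comm.1 hU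
  have hV' : V * Vᴴ = 1 := mul_eq_one_comm.1 hV
  have hspec : ρ = U * Matrix.diagonal (fun i => (r i : ℂ)) * Uᴴ := by
    have := hH.spectral_theorem
    rw [Unitary.conjStarAlgAut_apply] at this
    exact this
  set Q := Vᴴ * U with hQ
  have hQ1 : Q * Qᴴ = 1 := by
    rw [hQ, Matrix.conjTranspose_mul, Matrix.conjTranspose_conjTranspose, Matrix.mul_assoc,
      ← Matrix.mul_assoc U, hU', Matrix.one_mul, hV]
  have hQ2 : Qᴴ * Q = 1 := mul_eq_one_comm.1 hQ1
  have hrow : ∀ s, ∑ i, ‖Q s i‖ ^ 2 = 1 := by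
    intro s
    have := congrFun (congrFun hQ1 s) s
    simp only [Matrix.mul_apply, Matrix.conjTranspose_apply, Matrix.one_apply_eq,
      RCLike.star_def, Complex.mul_conj'] at this
    exact_mod_cast this
  have hcol : ∀ i, ∑ s, ‖Q s i‖ ^ 2 = 1 := by
    intro i
    have := congrFun (congrFun hQ2 i) i
    simp only [Matrix.mul_apply, Matrix.conjTranspose_apply, Matrix.one_apply_eq,
      RCLike.star_def, Complex.conj_mul'] at this
    exact_mod_cast this
  have hdiag : ∀ s, ((Vᴴ * ρ * V) s s).re = ∑ i, r i * ‖Q s i‖ ^ 2 := by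
    intro s
    have h1 : Vᴴ * ρ * V = Q * Matrix.diagonal (fun i => (r i : ℂ)) * Qᴴ := by
      rw [hspec, hQ]
      simp [Matrix.conjTranspose_mul, Matrix.mul_assoc]
    rw [h1, Matrix.mul_apply]
    have h2 : ∀ i, (Q * Matrix.diagonal (fun i => (r i : ℂ))) s i * Qᴴ i s
        = ((r i * ‖Q s i‖ ^ 2 : ℝ) : ℂ) := by
      intro i
      rw [Matrix.mul_diagonal, Matrix.conjTranspose_apply, RCLike.star_def, mul_right_comm,
        Complex.mul_conj']
      push_cast
      ring
    rw [Finset.sum_congr rfl fun i _ => h2 i, ← Complex.ofReal_sum, Complex.ofReal_re]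
  have hrsum : ∑ i, r i = 1 := by
    have h1 : ((∑ i, r i : ℝ) : ℂ) = 1 := by
      rw [← htr, hH.trace_eq_sum_eigenvalues]
      push_cast
      rfl
    exact_mod_cast h1
  rw [entropy_eq_sum hH]
  have key : ∑ i, ∑ s, ‖Q s i‖ ^ 2 * (r i - q s) ≤
      ∑ i, ∑ s, ‖Q s i‖ ^ 2 * (r i * Real.log (r i) - r i * Real.log (q s)) :=
    Finset.sum_le_sum fun i _ => Finset.sum_le_sum fun s _ =>
      mul_le_mul_of_nonneg_left (sub_le_mul_log_sub_mul_log (hr i) (hq s)) (by positivity)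
  have h1 : ∑ i, ∑ s, ‖Q s i‖ ^ 2 * (r i - q s) = 0 := by
    simp only [mul_sub, Finset.sum_sub_distrib]
    rw [Finset.sum_comm (f := fun i s => ‖Q s i‖ ^ 2 * q s)]
    simp only [← Finset.sum_mul, hrow, hcol, one_mul, hrsum, hq1, sub_self]
  have h2 : ∑ i, ∑ s, ‖Q s i‖ ^ 2 * (r i * Real.log (r i) - r i * Real.log (q s))
      = ∑ i, r i * Real.log (r i) - ∑ s, ((Vᴴ * ρ * V) s s).re * Real.log (q s) := by
    simp only [mul_sub, Finset.sum_sub_distrib]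
    rw [Finset.sum_comm (f := fun i s => ‖Q s i‖ ^ 2 * (r i * Real.log (q s)))]
    simp only [← Finset.sum_mul, hcol, one_mul, hdiag]
    congr 1
    refine Finset.sum_congr rfl fun s _ => ?_
    rw [Finset.sum_mul]
    exact Finset.sum_congr rfl fun i _ => by ring
  have h3 : ∑ i, Real.negMulLog (r i) = -∑ i, r i * Real.log (r i) := by
    simp [Real.negMulLog]
  rw [h1, h2] at key
  rw [h3]
  linarith

end gibbs

/-! ### Entropy bound by one-mode expectations -/

theorem neg_mul_log_le_sqrt {x : ℝ} (h0 : 0 < x) (h1 : x < 1) :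
    -(x * Real.log x) ≤ 2 * Real.sqrt (x * (1 - x)) := by
  set y := Real.sqrt x with hy
  have hy0 : 0 < y := Real.sqrt_pos.2 h0
  have hxy : x = y ^ 2 := (Real.sq_sqrt h0.le).symm
  have hy1 : y < 1 := by nlinarith
  have h2 : -Real.log x ≤ 2 * (y⁻¹ - 1) := by
    have h := Real.log_le_sub_one_of_pos (inv_pos.2 hy0)
    rw [Real.log_inv] at h
    rw [hxy, Real.log_pow]
    push_cast
    linarith
  have h3 : -(x * Real.log x) ≤ 2 * (y * (1 - y)) := by
    have h := mul_le_mul_of_nonneg_left h2 h0.le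
    have h4 : x * (2 * (y⁻¹ - 1)) = 2 * (y * (1 - y)) := by
      rw [hxy]; field_simp
    linarith
  refine h3.trans (mul_le_mul_of_nonneg_left (Real.le_sqrt_of_sq_le ?_) two_pos.le)
  rw [hxy]
  have : 0 ≤ y ^ 2 * (1 - y) * (2 * y) := by
    have : 0 ≤ 1 - y := by linarith
    positivity
  nlinarith

theorem exists_binary_entropy_bound {x δ : ℝ} (h0 : 0 ≤ x) (h1 : x ≤ 1) (hδ : 0 < δ) :
    ∃ q : ℝ, 0 < q ∧ q < 1 ∧
      -(x * Real.log q + (1 - x) * Real.log (1 - q)) ≤ 4 * Real.sqrt (x * (1 - x)) + δ := by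
  have he : Real.exp (-δ) < 1 := by simpa using Real.exp_lt_exp.2 (show -δ < 0 by linarith)
  have he0 := Real.exp_pos (-δ)
  rcases h0.eq_or_lt with rfl | h0
  · refine ⟨1 - Real.exp (-δ), by linarith, by linarith, ?_⟩
    simp
  rcases h1.eq_or_lt with rfl | h1
  · refine ⟨Real.exp (-δ), by linarith, by linarith, ?_⟩
    simp
  · refine ⟨x, h0, h1, ?_⟩
    have h2 := neg_mul_log_le_sqrt h0 h1
    have h3 := neg_mul_log_le_sqrt (x := 1 - x) (by linarith) (by linarith)
    rw [sub_sub_cancel, mul_comm (1 - x) x] at h3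
    linarith

section modes

variable {κ : Type*} [Fintype κ] [DecidableEq κ]

open scoped ComplexOrder

theorem entropy_le_sum_sqrt {ρ : Matrix (κ → Fin 2) (κ → Fin 2) ℂ} (hρ : ρ.PosSemidef)
    (htr : ρ.trace = 1) (Z W : κ → Matrix (κ → Fin 2) (κ → Fin 2) ℂ) (hZh : ∀ k, (Z k)ᴴ = Z k)
    (hZ : ∀ k, Z k * Z k = 1) (hZZ : ∀ k l, k ≠ l → Z k * Z l = Z l * Z k)
    (hW : ∀ k, W k * W k = 1) (hWZ : ∀ k, Z k * W k = -(W k * Z k))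
    (hWZ' : ∀ k l, k ≠ l → Z l * W k = W k * Z l) :
    entropy ρ ≤ ∑ k, 2 * Real.sqrt (1 - (ρ * Z k).trace.re ^ 2) := by
  obtain ⟨V, hV, hVZ⟩ := exists_joint_unitary Z W hZh hZ hZZ hW hWZ hWZ'
  have hV' : V * Vᴴ = 1 := mul_eq_one_comm.1 hV
  set p : (κ → Fin 2) → ℝ := fun s => ((Vᴴ * ρ * V) s s).re with hp
  set z : κ → ℝ := fun k => (ρ * Z k).trace.re with hz
  have hp0 : ∀ s, 0 ≤ p s := fun s =>
    (Complex.le_def.1 ((hρ.conjTranspose_mul_mul_same V).diag_nonneg (i := s))).1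
  have hp1 : ∑ s, p s = 1 := by
    have h : (Vᴴ * ρ * V).trace = 1 := by
      rw [Matrix.trace_mul_cycle, hV', one_mul, htr]
    have := congrArg Complex.re h
    simpa [Matrix.trace, hp] using this
  have hpz : ∀ k, ∑ s, p s * spinSign (s k) = z k := by
    intro k
    have h : (Vᴴ * ρ * V * (Vᴴ * Z k * V)).trace = (ρ * Z k).trace := by
      have h1 : Vᴴ * ρ * V * (Vᴴ * Z k * V) = Vᴴ * (ρ * Z k) * V := by
        calc _ = Vᴴ * ρ * (V * Vᴴ) * Z k * V := by simp only [Matrix.mul_assoc]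
          _ = _ := by rw [hV', Matrix.mul_one]; simp only [Matrix.mul_assoc]
      rw [h1, Matrix.trace_mul_cycle, hV', one_mul]
    rw [hVZ] at h
    simp only [hz]
    rw [← h]
    simp only [Matrix.trace, Matrix.diag_apply, Matrix.mul_diagonal, Complex.re_sum,
      Complex.re_mul_ofReal, hp]
  have hbd : ∀ k, |z k| ≤ 1 := by
    intro k
    rw [← hpz, ← hp1]
    refine (Finset.abs_sum_le_sum_abs _ _).trans (Finset.sum_le_sum fun s _ => ?_)
    rw [abs_mul, abs_of_nonneg (hp0 s)]
    have : |spinSign (s k)| = 1 := by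
      unfold spinSign; split_ifs <;> simp
    rw [this, mul_one]
  have hstep : ∀ δ > 0, entropy ρ ≤ ∑ k, (2 * Real.sqrt (1 - z k ^ 2) + δ) := by
    intro δ hδ
    have hq : ∀ k, ∃ q : ℝ, 0 < q ∧ q < 1 ∧
        -((1 + z k) / 2 * Real.log q + (1 - (1 + z k) / 2) * Real.log (1 - q))
          ≤ 4 * Real.sqrt ((1 + z k) / 2 * (1 - (1 + z k) / 2)) + δ := fun k => by
      have := abs_le.1 (hbd k)
      exact exists_binary_entropy_bound (by linarith) (by linarith) hδ
    choose q hq0 hq1 hq using hq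
    set w : κ → Fin 2 → ℝ := fun k s => if s = 0 then q k else 1 - q k with hw
    have hw0 : ∀ k s, 0 < w k s := by
      intro k s
      simp only [hw]
      split_ifs
      · exact hq0 k
      · linarith [hq1 k]
    have hwsum : ∑ s : κ → Fin 2, ∏ k, w k (s k) = 1 := by
      have := (Finset.prod_univ_sum (fun _ : κ => (Finset.univ : Finset (Fin 2))) w).symm
      simp only [Fintype.piFinset_univ] at this
      rw [this]
      simp [hw]
    have hlog : ∀ k s, Real.log (w k s) = (1 + spinSign s) / 2 * Real.log (q k)
        + (1 - spinSign s) / 2 * Real.log (1 - q k) := by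
      intro k s
      simp only [hw, spinSign]
      split_ifs <;> norm_num
    have hG := entropy_le_neg_sum_mul_log hρ htr hV
      (fun s => Finset.prod_pos fun k _ => hw0 k (s k)) hwsum
    refine hG.trans ?_
    have h1 : -∑ s, ((Vᴴ * ρ * V) s s).re * Real.log (∏ k, w k (s k))
        = ∑ k, -((1 + z k) / 2 * Real.log (q k) + (1 - (1 + z k) / 2) * Real.log (1 - q k)) := by
      rw [Finset.sum_neg_distrib]
      congr 1
      have h2 : ∀ s, ((Vᴴ * ρ * V) s s).re * Real.log (∏ k, w k (s k))
          = ∑ k, p s * Real.log (w k (s k)) := by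
        intro s
        rw [Real.log_prod fun k _ => (hw0 k (s k)).ne', Finset.mul_sum]
      rw [Finset.sum_congr rfl fun s _ => h2 s, Finset.sum_comm]
      refine Finset.sum_congr rfl fun k _ => ?_
      have h3 : ∀ s : κ → Fin 2, p s * Real.log (w k (s k))
          = p s * ((Real.log (q k) + Real.log (1 - q k)) / 2)
            + p s * spinSign (s k) * ((Real.log (q k) - Real.log (1 - q k)) / 2) := by
        intro s
        rw [hlog]
        ring
      rw [Finset.sum_congr rfl fun s _ => h3 s, Finset.sum_add_distrib, ← Finset.sum_mul,
        ← Finset.sum_mul, hp1, hpz]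
      ring
    rw [h1]
    refine Finset.sum_le_sum fun k _ => (hq k).trans (le_of_eq ?_)
    have h4 : (1 + z k) / 2 * (1 - (1 + z k) / 2) = (1 - z k ^ 2) * (1 / 2) ^ 2 := by ring
    have h5 : 0 ≤ 1 - z k ^ 2 := by
      have := abs_le.1 (hbd k)
      nlinarith
    rw [h4, Real.sqrt_mul h5, Real.sqrt_sq (by norm_num)]
    ring
  refine le_of_forall_pos_le_add fun ε hε => ?_
  have hc : (0 : ℝ) < Fintype.card κ + 1 := by positivity
  refine (hstep (ε / (Fintype.card κ + 1)) (div_pos hε hc)).trans ?_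
  rw [Finset.sum_add_distrib]
  gcongr
  rw [Finset.sum_const, Finset.card_univ, nsmul_eq_mul, mul_div_assoc', div_le_iff₀ hc]
  nlinarith

end modes

/-! ### Normal form of skew-symmetric real matrices -/

theorem exists_orthonormal_of_skew {E : Type*} [NormedAddCommGroup E] [InnerProductSpace ℝ E]
    [FiniteDimensional ℝ E] (m : ℕ) (hm : Module.finrank ℝ E = 2 * m) (A : E →ₗ[ℝ] E)
    (hA : ∀ x y, inner ℝ (A x) y = -inner ℝ x (A y)) :
    ∃ (e : Fin m × Fin 2 → E) (s : Fin m → ℝ), Orthonormal ℝ e ∧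
      ∀ k, A (e (k, 0)) = s k • e (k, 1) ∧ A (e (k, 1)) = -(s k • e (k, 0)) := by
  induction m generalizing E with
  | zero => exact ⟨fun p => p.1.elim0, fun k => k.elim0,
      ⟨fun p => p.1.elim0, fun p => p.1.elim0⟩, fun k => k.elim0⟩
  | succ m ih =>
    by_cases hA0 : A = 0
    · let b := (stdOrthonormalBasis ℝ E).reindex
        ((finCongr (by rw [hm, mul_comm])).trans (finProdFinEquiv (m := m + 1) (n := 2)).symm)
      exact ⟨b, 0, b.orthonormal, fun k => by simp [hA0]⟩
    have hT : (A ∘ₗ A).IsSymmetric := fun x y => by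
      simp only [LinearMap.comp_apply]
      rw [hA, hA, neg_neg]
    obtain ⟨i, hi⟩ : ∃ i, A (hT.eigenvectorBasis rfl i) ≠ 0 := by
      by_contra! h
      exact hA0 ((hT.eigenvectorBasis rfl).toBasis.ext fun i => by simpa using h i)
    set u := hT.eigenvectorBasis rfl i with hu
    have hu1 : inner ℝ u u = 1 := by
      rw [real_inner_self_eq_norm_sq, (hT.eigenvectorBasis rfl).orthonormal.1 i, one_pow]
    have hTu : A (A u) = hT.eigenvalues rfl i • u := hT.apply_eigenvectorBasis rfl i
    set c := ‖A u‖ with hc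
    have hc0 : c ≠ 0 := norm_ne_zero_iff.2 hi
    have hAA : A (A u) = -(c ^ 2 • u) := by
      have h1 := hA (A u) u
      rw [hTu, inner_smul_left, hu1, real_inner_self_eq_norm_sq] at h1
      rw [hTu, show hT.eigenvalues rfl i = -c ^ 2 by simpa using h1, neg_smul]
    set u' := c⁻¹ • A u with hu'
    have h1 : A u = c • u' := by rw [hu', smul_smul, mul_inv_cancel₀ hc0, one_smul]
    have h2 : A u' = -(c • u) := by
      rw [hu', map_smul, hAA, smul_neg, smul_smul, pow_two, inv_mul_cancel_left₀ hc0]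
    have hu'1 : inner ℝ u' u' = 1 := by
      rw [hu', inner_smul_left, inner_smul_right, real_inner_self_eq_norm_sq, ← hc]
      simp only [RCLike.conj_to_real]
      field_simp
    have huu' : inner ℝ u u' = 0 := by
      have h3 := hA u u
      rw [real_inner_comm] at h3
      rw [hu', inner_smul_right]
      have : inner ℝ u (A u) = 0 := by linarith
      rw [this, mul_zero]
    have huu'' : inner ℝ u' u = 0 := by rw [real_inner_comm, huu']
    have ho : Orthonormal ℝ ![u, u'] := by
      rw [orthonormal_iff_ite]
      intro i j
      fin_cases i <;> fin_cases j
      · exact hu1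
      · exact huu'
      · exact huu''
      · exact hu'1
    set W := Submodule.span ℝ (Set.range ![u, u']) with hW
    have hWd : Module.finrank ℝ W = 2 := by
      rw [hW, finrank_span_eq_card ho.linearIndependent]; simp
    have hWo : Module.finrank ℝ Wᗮ = 2 * m := by
      have := W.finrank_add_finrank_orthogonal
      omega
    have huW : u ∈ W := Submodule.subset_span ⟨0, rfl⟩
    have hu'W : u' ∈ W := Submodule.subset_span ⟨1, rfl⟩
    have hmem : ∀ x, inner ℝ u x = 0 → inner ℝ u' x = 0 → x ∈ Wᗮ := by
      intro x hx hx'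
      rw [Submodule.mem_orthogonal]
      intro w hw
      refine Submodule.span_induction (p := fun w _ => inner ℝ w x = 0) ?_ (by simp) ?_ ?_ hw
      · rintro _ ⟨i, rfl⟩
        fin_cases i
        · exact hx
        · exact hx'
      · intro a b _ _ ha hb
        rw [inner_add_left, ha, hb, add_zero]
      · intro a b _ hb
        rw [inner_smul_left, hb, mul_zero]
    have hinv : ∀ x ∈ Wᗮ, A x ∈ Wᗮ := by
      intro x hx
      have e1 := (Submodule.mem_orthogonal _ _).1 hx u huW
      have e2 := (Submodule.mem_orthogonal _ _).1 hx u' hu'W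
      refine hmem _ ?_ ?_
      · have := hA u x
        rw [h1, inner_smul_left, e2, mul_zero] at this
        linarith
      · have := hA u' x
        rw [h2, inner_neg_left, inner_smul_left, e1, mul_zero] at this
        linarith
    obtain ⟨e, s, he, hes⟩ := ih hWo (A.restrict hinv) fun x y => hA x y
    rw [orthonormal_iff_ite] at he
    have hperp : ∀ b p, inner ℝ (![u, u'] b) (e p : E) = 0 := fun b p =>
      (Submodule.mem_orthogonal _ _).1 (e p).2 _ (Submodule.subset_span ⟨b, rfl⟩)
    refine ⟨fun p => Fin.cases (![u, u'] p.2) (fun k => (e (k, p.2) : E)) p.1,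
      Fin.cons c s, ?_, ?_⟩
    · rw [orthonormal_iff_ite] at ho ⊢
      rintro ⟨i, b⟩ ⟨j, b'⟩
      refine Fin.cases ?_ (fun i => ?_) i <;> refine Fin.cases ?_ (fun j => ?_) j
      · simpa [Prod.ext_iff] using ho b b'
      · simpa [Prod.ext_iff, (Fin.succ_ne_zero j).symm] using hperp b (j, b')
      · rw [real_inner_comm]
        simpa [Prod.ext_iff] using hperp b' (i, b)
      · simpa [Prod.ext_iff] using he (i, b) (j, b')
    · intro k
      refine Fin.cases ?_ (fun k => ?_) k
      · exact ⟨h1, h2⟩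
      · have := hes k
        exact ⟨congrArg Subtype.val this.1, congrArg Subtype.val this.2⟩

theorem exists_skew_modes {κ : Type*} [Fintype κ] [DecidableEq κ]
    (A : Matrix (κ × Fin 2) (κ × Fin 2) ℝ) (hA : Aᵀ = -A) :
    ∃ (e : κ × Fin 2 → κ × Fin 2 → ℝ) (s : κ → ℝ),
      (∀ p q, e p ⬝ᵥ e q = if p = q then 1 else 0) ∧
      ∀ k, A *ᵥ e (k, 0) = s k • e (k, 1) ∧ A *ᵥ e (k, 1) = -(s k • e (k, 0)) := by
  have hfin : Module.finrank ℝ (EuclideanSpace ℝ (κ × Fin 2)) = 2 * Fintype.card κ := by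
    simp [mul_comm]
  obtain ⟨e, s, he, hes⟩ := exists_orthonormal_of_skew _ hfin (Matrix.toLpLin 2 2 A) (by
    intro x y
    simp only [EuclideanSpace.inner_eq_star_dotProduct, Matrix.toLpLin_apply, star_trivial]
    rw [Matrix.dotProduct_mulVec, ← Matrix.mulVec_transpose, hA, Matrix.neg_mulVec,
      neg_dotProduct])
  rw [orthonormal_iff_ite] at he
  let f := Fintype.equivFin κ
  refine ⟨fun p => (e (f p.1, p.2)).ofLp, fun k => s (f k), fun p q => ?_, fun k => ?_⟩
  · have := he (f q.1, q.2) (f p.1, p.2)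
    rw [EuclideanSpace.inner_eq_star_dotProduct, star_trivial] at this
    rw [this]
    simp [Prod.ext_iff, eq_comm]
  · have := hes (f k)
    exact ⟨congrArg WithLp.ofLp this.1, congrArg WithLp.ofLp this.2⟩

/-! ### Entropy bound by off-diagonal covariances -/

theorem sum_sq_le_one_of_orthogonal {κ β : Type*} [Fintype κ] [DecidableEq κ] [Fintype β]
    [DecidableEq β] (w : κ → β → ℝ) (c : κ → ℝ) (hc : ∀ k, c k ≤ 1)
    (hw : ∀ k l, w k ⬝ᵥ w l = if k = l then c k else 0) (q : β) : ∑ k, w k q ^ 2 ≤ 1 := by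
  have h0 : 0 ≤ ∑ x, ((if x = q then 1 else 0) - ∑ k, w k q * w k x) ^ 2 :=
    Finset.sum_nonneg fun _ _ => sq_nonneg _
  have h1 : ∑ x, ((if x = q then 1 else 0) - ∑ k, w k q * w k x) ^ 2
      = 1 - 2 * ∑ k, w k q ^ 2 + ∑ k, w k q ^ 2 * c k := by
    have h2 : ∀ x, ((if x = q then 1 else 0) - ∑ k, w k q * w k x) ^ 2
        = (if x = q then 1 - 2 * ∑ k, w k q * w k x else 0)
          + ∑ k, ∑ l, w k q * w l q * (w k x * w l x) := by
      intro x
      have h3 : (∑ k, w k q * w k x) ^ 2 = ∑ k, ∑ l, w k q * w l q * (w k x * w l x) := by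
        rw [pow_two, Finset.sum_mul_sum]
        exact Finset.sum_congr rfl fun k _ => Finset.sum_congr rfl fun l _ => by ring
      rw [sub_sq, h3]
      split_ifs <;> ring
    rw [Finset.sum_congr rfl fun x _ => h2 x, Finset.sum_add_distrib]
    congr 1
    · simp [pow_two]
    · rw [Finset.sum_comm]
      refine Finset.sum_congr rfl fun k _ => ?_
      rw [Finset.sum_comm]
      have h4 : ∀ l, ∑ x, w k q * w l q * (w k x * w l x)
          = w k q * w l q * (if k = l then c k else 0) := by
        intro l
        rw [← hw, dotProduct, Finset.mul_sum]
      simp [h4, pow_two]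
  have h5 : ∑ k, w k q ^ 2 * c k ≤ ∑ k, w k q ^ 2 :=
    Finset.sum_le_sum fun k _ => mul_le_of_le_one_right (sq_nonneg _) (hc k)
  linarith

theorem sum_sqrt_le_sum_abs {κ β : Type*} [Fintype κ] [DecidableEq κ] [Fintype β]
    (A : Matrix (κ × Fin 2) (κ × Fin 2) ℝ) (R : Matrix β (κ × Fin 2) ℝ)
    (hR : Rᵀ * R = 1 + A * A) (e : κ × Fin 2 → κ × Fin 2 → ℝ) (s : κ → ℝ)
    (he : ∀ p q, e p ⬝ᵥ e q = if p = q then 1 else 0)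
    (hA : ∀ k, A *ᵥ e (k, 0) = s k • e (k, 1) ∧ A *ᵥ e (k, 1) = -(s k • e (k, 0))) :
    ∑ k, Real.sqrt (1 - s k ^ 2) ≤ ∑ q, ∑ p, |R q p| := by
  classical
  set x : κ → β → ℝ := fun k => R *ᵥ e (k, 0) with hx
  have hxx : ∀ k l, x k ⬝ᵥ x l = if k = l then 1 - s k ^ 2 else 0 := by
    intro k l
    have h1 : x k ⬝ᵥ x l = e (k, 0) ⬝ᵥ ((Rᵀ * R) *ᵥ e (l, 0)) := by
      rw [hx, ← Matrix.mulVec_mulVec, Matrix.dotProduct_mulVec (e (k, 0)), Matrix.vecMul_transpose]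
    rw [h1, hR, Matrix.add_mulVec, Matrix.one_mulVec, ← Matrix.mulVec_mulVec, (hA l).1,
      Matrix.mulVec_smul, (hA l).2, dotProduct_add, dotProduct_smul, dotProduct_neg,
      dotProduct_smul, he]
    by_cases h : k = l
    · simp [h]; ring
    · simp [h]
  set t : κ → ℝ := fun k => Real.sqrt (1 - s k ^ 2) with ht
  have htsq : ∀ k, t k * t k = 1 - s k ^ 2 := by
    intro k
    refine Real.mul_self_sqrt ?_
    have := hxx k k
    rw [if_pos rfl] at this
    rw [← this]
    exact Finset.sum_nonneg fun _ _ => mul_self_nonneg _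
  set w : κ → β → ℝ := fun k => (t k)⁻¹ • x k with hw
  have hwq := sum_sq_le_one_of_orthogonal w (fun k => if t k = 0 then 0 else 1)
    (fun k => by split_ifs <;> norm_num) (fun k l => by
      rw [hw]
      simp only [smul_dotProduct, dotProduct_smul, hxx, smul_eq_mul]
      by_cases h : k = l
      · rw [← h, if_pos rfl, if_pos rfl, ← htsq]
        split_ifs with h0
        · simp [h0]
        · field_simp
      · simp [h])
  have hep := sum_sq_le_one_of_orthogonal (fun k => e (k, 0)) (fun _ => 1) (fun _ => le_rfl)
    (fun k l => by simp [he])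
  have htw : ∀ k, t k = ∑ q, ∑ p, R q p * (w k q * e (k, 0) p) := by
    intro k
    have h1 : t k = w k ⬝ᵥ x k := by
      rw [hw]
      simp only [smul_dotProduct, hxx, if_true, smul_eq_mul, ← htsq]
      by_cases h0 : t k = 0
      · simp [h0]
      · field_simp
    rw [h1]
    simp only [dotProduct, hx, Matrix.mulVec, Finset.mul_sum]
    exact Finset.sum_congr rfl fun q _ => Finset.sum_congr rfl fun p _ => by ring
  calc ∑ k, t k = ∑ k, ∑ q, ∑ p, R q p * (w k q * e (k, 0) p) :=
        Finset.sum_congr rfl fun k _ => htw k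
    _ = ∑ q, ∑ p, R q p * ∑ k, w k q * e (k, 0) p := by
        rw [Finset.sum_comm]
        refine Finset.sum_congr rfl fun q _ => ?_
        rw [Finset.sum_comm]
        exact Finset.sum_congr rfl fun p _ => (Finset.mul_sum _ _ _).symm
    _ ≤ ∑ q, ∑ p, |R q p| := by
        refine Finset.sum_le_sum fun q _ => Finset.sum_le_sum fun p _ => ?_
        refine (le_abs_self _).trans ?_
        rw [abs_mul]
        refine mul_le_of_le_one_right (abs_nonneg _) ?_
        calc |∑ k, w k q * e (k, 0) p| ≤ ∑ k, |w k q * e (k, 0) p| :=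
              Finset.abs_sum_le_sum_abs _ _
          _ ≤ ∑ k, (w k q ^ 2 + e (k, 0) p ^ 2) / 2 := by
              refine Finset.sum_le_sum fun k _ => abs_le.2 ⟨?_, ?_⟩
              · nlinarith [sq_nonneg (w k q + e (k, 0) p)]
              · nlinarith [sq_nonneg (w k q - e (k, 0) p)]
          _ ≤ 1 := by
              rw [← Finset.sum_div, Finset.sum_add_distrib]
              linarith [hwq q, hep p]

open scoped ComplexOrder in
theorem entropy_le_of_covariance {κ β : Type*} [Fintype κ] [LinearOrder κ] [Fintype β]
    {ρ : Matrix (κ → Fin 2) (κ → Fin 2) ℂ} (hρ : ρ.PosSemidef) (htr : ρ.trace = 1)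
    (A : Matrix (κ × Fin 2) (κ × Fin 2) ℝ) (hA : Aᵀ = -A)
    (hcov : ∀ p q, (ρ * (majorana p * majorana q)).trace
      = (if p = q then 1 else 0) + Complex.I * (A p q : ℂ))
    (R : Matrix β (κ × Fin 2) ℝ) (hR : Rᵀ * R = 1 + A * A) :
    entropy ρ ≤ 2 * ∑ q, ∑ p, |R q p| := by
  obtain ⟨e, s, he, hAe⟩ := exists_skew_modes A hA
  have hsq : ∀ p, field (e p) * field (e p) = 1 := fun p => field_mul_self (by simp [he])
  have hac : ∀ p q, p ≠ q → field (e p) * field (e q) = -(field (e q) * field (e p)) :=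
    fun p q h => field_anticomm (by simp [he, h])
  have hcomm : ∀ p q r, p ≠ r → q ≠ r →
      field (e p) * field (e q) * field (e r) = field (e r) * (field (e p) * field (e q)) := by
    intro p q r h1 h2
    rw [mul_assoc, hac q r h2, mul_neg, ← mul_assoc, hac p r h1, neg_mul, neg_neg, mul_assoc]
  set f0 : κ → Matrix (κ → Fin 2) (κ → Fin 2) ℂ := fun k => field (e (k, 0)) with hf0
  set f1 : κ → Matrix (κ → Fin 2) (κ → Fin 2) ℂ := fun k => field (e (k, 1)) with hf1
  have h01 : ∀ k : κ, ((k, 0) : κ × Fin 2) ≠ (k, 1) := fun k => by simp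
  have hZ : ∀ k l, k ≠ l → f0 k * f1 k * f0 l = f0 l * (f0 k * f1 k) := fun k l h =>
    hcomm _ _ _ (by simp [h]) (by simp [h])
  have hZ1 : ∀ k l, k ≠ l → f0 k * f1 k * f1 l = f1 l * (f0 k * f1 k) := fun k l h =>
    hcomm _ _ _ (by simp [h]) (by simp [h])
  have hflip : ∀ k, f0 k * f1 k * f0 k = -f1 k := by
    intro k
    rw [hac _ _ (h01 k), neg_mul, mul_assoc, hsq, mul_one]
  refine (entropy_le_sum_sqrt hρ htr (fun k => (-Complex.I) • (f0 k * f1 k)) f0 ?_ ?_ ?_ ?_ ?_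
    ?_).trans ?_
  · intro k
    rw [Matrix.conjTranspose_smul, Matrix.conjTranspose_mul, field_conjTranspose,
      field_conjTranspose, hac _ _ (h01 k).symm]
    simp [hf0, hf1]
  · intro k
    rw [smul_mul_smul_comm, ← mul_assoc, hflip, neg_mul (f1 k), show f1 k * f1 k = 1 from hsq _]
    simp
  · intro k l h
    simp only [smul_mul_smul_comm]
    rw [← mul_assoc, hZ k l h, mul_assoc, hZ1 k l h, ← mul_assoc]
  · exact fun k => hsq _
  · intro k
    rw [smul_mul_assoc, hflip, mul_smul_comm, ← mul_assoc, hsq, one_mul, smul_neg]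
  · intro k l h
    rw [smul_mul_assoc, hZ l k h.symm, mul_smul_comm]
  · rw [← Finset.mul_sum]
    refine mul_le_mul_of_nonneg_left ?_ two_pos.le
    refine le_trans (Finset.sum_le_sum fun k _ => ?_) (sum_sqrt_le_sum_abs A R hR e s he hAe)
    refine Real.sqrt_le_sqrt (le_of_eq ?_)
    have h1 : (ρ * ((-Complex.I) • (f0 k * f1 k))).trace = ((e (k, 0) ⬝ᵥ A *ᵥ e (k, 1) : ℝ) : ℂ) := by
      have h2 : (ρ * (f0 k * f1 k)).trace = Complex.I * ((e (k, 0) ⬝ᵥ A *ᵥ e (k, 1) : ℝ) : ℂ) := by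
        simp only [hf0, hf1]
        rw [field_mul, Matrix.mul_sum, Matrix.trace_sum]
        simp only [Matrix.mul_sum, Matrix.trace_sum, Matrix.mul_smul, Matrix.trace_smul, hcov,
          smul_eq_mul, mul_add, Finset.sum_add_distrib]
        have h3 : ∑ p, ∑ q, (e (k, 0) p : ℂ) * e (k, 1) q * (if p = q then 1 else 0) = 0 := by
          have := he (k, 0) (k, 1)
          rw [if_neg (h01 k)] at this
          have h4 := congrArg (fun x : ℝ => (x : ℂ)) this
          simpa [dotProduct] using h4
        rw [h3, zero_add]
        simp only [dotProduct, Matrix.mulVec, Complex.ofReal_sum, Complex.ofReal_mul,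
          Finset.mul_sum]
        exact Finset.sum_congr rfl fun p _ => Finset.sum_congr rfl fun q _ => by ring
      rw [Matrix.mul_smul, Matrix.trace_smul, h2, smul_eq_mul, ← mul_assoc]
      simp
    rw [h1, (hAe k).2, dotProduct_neg, dotProduct_smul, he, if_pos rfl]
    simp

/-! ### Heisenberg evolution of the field operators -/

section heisenberg

variable {ι : Type*} [Fintype ι] [LinearOrder ι]

theorem majorana_commutator (p q r : ι × Fin 2) :
    majorana p * majorana q * majorana r - majorana r * (majorana p * majorana q)
      = (if q = r then (2 : ℂ) else 0) • majorana p
        - (if p = r then (2 : ℂ) else 0) • majorana q := by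
  have h1 : majorana p * majorana q * majorana r - majorana r * (majorana p * majorana q)
      = majorana p * (majorana q * majorana r + majorana r * majorana q)
        - (majorana p * majorana r + majorana r * majorana p) * majorana q := by
    noncomm_ring
  rw [h1, majorana_mul_add, majorana_mul_add]
  split_ifs <;> simp

/-- The quadratic operator `∑ G_{pq} a_p a_q`. -/
def quadratic (G : Matrix (ι × Fin 2) (ι × Fin 2) ℂ) : Matrix (ι → Fin 2) (ι → Fin 2) ℂ :=
  ∑ p, ∑ q, G p q • (majorana p * majorana q)

/-- The field operator as a linear map. -/
def fieldLinear : (ι × Fin 2 → ℝ) →ₗ[ℝ] Matrix (ι → Fin 2) (ι → Fin 2) ℂ where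
  toFun := field
  map_add' v w := by simp [field, add_smul, Finset.sum_add_distrib]
  map_smul' c v := by
    simp only [field, Pi.smul_apply, smul_eq_mul, Complex.ofReal_mul, mul_smul, RingHom.id_apply,
      Finset.smul_sum]
    rfl

theorem quadratic_commutator (G : Matrix (ι × Fin 2) (ι × Fin 2) ℂ)
    (B : Matrix (ι × Fin 2) (ι × Fin 2) ℝ)
    (hB : ∀ p q, (B p q : ℂ) = 2 * Complex.I * (G p q - G q p)) (v : ι × Fin 2 → ℝ) :
    (Complex.I • quadratic G) * field v - field v * (Complex.I • quadratic G)
      = field (B *ᵥ v) := by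
  have h1 : ∀ r, quadratic G * majorana r - majorana r * quadratic G
      = ∑ p, (2 * (G p r - G r p)) • majorana p := by
    intro r
    simp only [quadratic, Finset.sum_mul, Finset.mul_sum, smul_mul_assoc, mul_smul_comm,
      ← Finset.sum_sub_distrib, ← smul_sub, majorana_commutator]
    simp only [smul_sub, Finset.sum_sub_distrib, smul_smul, mul_sub, sub_smul]
    congr 1
    · simp [mul_comm]
    · rw [Finset.sum_comm]
      simp [mul_comm]
  have h2 : (Complex.I • quadratic G) * field v - field v * (Complex.I • quadratic G)
      = ∑ r, (Complex.I * v r) • (quadratic G * majorana r - majorana r * quadratic G) := by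
    simp only [field, Finset.mul_sum, Finset.sum_mul, smul_mul_smul_comm, smul_sub,
      Finset.sum_sub_distrib, mul_comm Complex.I]
  rw [h2]
  simp only [h1, Finset.smul_sum, smul_smul]
  rw [Finset.sum_comm, field]
  refine Finset.sum_congr rfl fun p _ => ?_
  rw [← Finset.sum_smul]
  congr 1
  simp only [Matrix.mulVec, dotProduct, Complex.ofReal_sum, Complex.ofReal_mul, hB]
  exact Finset.sum_congr rfl fun r _ => by ring

open scoped Matrix.Norms.Operator in
theorem exp_mul_field_mul_exp (C : Matrix (ι → Fin 2) (ι → Fin 2) ℂ)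
    (B : Matrix (ι × Fin 2) (ι × Fin 2) ℝ)
    (hC : ∀ v, C * field v - field v * C = field (B *ᵥ v)) (v : ι × Fin 2 → ℝ) (t : ℝ) :
    NormedSpace.exp (t • C) * field v * NormedSpace.exp (t • -C)
      = field (NormedSpace.exp (t • B) *ᵥ v) := by
  let L : Matrix (ι × Fin 2) (ι × Fin 2) ℝ →ₗ[ℝ] Matrix (ι → Fin 2) (ι → Fin 2) ℂ :=
    fieldLinear ∘ₗ ((Matrix.mulVecBilin ℝ ℝ).flip v)
  have hL : ∀ M, L M = field (M *ᵥ v) := fun M => rfl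
  have hd : ∀ t : ℝ, HasDerivAt (fun u : ℝ => NormedSpace.exp (u • -C) * L (NormedSpace.exp (u • B))
      * NormedSpace.exp (u • C)) 0 t := by
    intro t
    have d1 := hasDerivAt_exp_smul_const (𝕂 := ℝ) (-C) t
    have d2 := hasDerivAt_exp_smul_const' (𝕂 := ℝ) C t
    have d3 : HasDerivAt (fun u : ℝ => L (NormedSpace.exp (u • B)))
        (C * L (NormedSpace.exp (t • B)) - L (NormedSpace.exp (t • B)) * C) t := by
      refine (L.toContinuousLinearMap.hasFDerivAt.comp_hasDerivAt t
        (hasDerivAt_exp_smul_const' (𝕂 := ℝ) B t)).congr_deriv ?_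
      change L (B * NormedSpace.exp (t • B)) = _
      rw [hL, hL, hC, Matrix.mulVec_mulVec]
    refine ((d1.mul d3).mul d2).congr_deriv ?_
    simp only [Pi.mul_apply]
    noncomm_ring
  have hconst := is_const_of_deriv_eq_zero (fun t => (hd t).differentiableAt)
    (fun t => (hd t).deriv) t 0
  simp only [zero_smul, NormedSpace.exp_zero, one_mul, mul_one, hL, Matrix.one_mulVec] at hconst
  have hinv : NormedSpace.exp (t • C) * NormedSpace.exp (t • -C) = 1 := by
    rw [smul_neg, ← Matrix.exp_add_of_commute _ _ (Commute.refl (t • C)).neg_right, add_neg_cancel,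
      NormedSpace.exp_zero]
  have hinv' := mul_eq_one_comm.1 hinv
  rw [← hconst]
  calc _ = (NormedSpace.exp (t • C) * NormedSpace.exp (t • -C))
        * field (NormedSpace.exp (t • B) *ᵥ v)
        * (NormedSpace.exp (t • C) * NormedSpace.exp (t • -C)) := by
        simp only [mul_assoc]
    _ = _ := by rw [hinv, one_mul, mul_one]

end heisenberg

/-! ### The XY Hamiltonian as a quadratic operator -/

/-- The coefficients of the XY Hamiltonian in terms of products of Majorana operators. -/
def coeff (n : ℕ) (μ γ ν : ℕ → ℝ) : Matrix (Fin n × Fin 2) (Fin n × Fin 2) ℂ :=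
  Matrix.of fun p q =>
    (if p.1 = q.1 then !![0, Complex.I * ν p.1; 0, 0] p.2 q.2 else 0)
    + if (p.1 : ℕ) + 1 = q.1 then
        !![0, -(Complex.I * (μ p.1 * (1 - γ p.1))); Complex.I * (μ p.1 * (1 + γ p.1)), 0] p.2 q.2
      else 0

theorem siteOp_mul_siteOp {n : ℕ} (j k : Fin n) (A B : Matrix (Fin 2) (Fin 2) ℂ) :
    siteOp j A * siteOp k B = tens fun i =>
      Function.update (fun _ => 1) j A i * Function.update (fun _ => 1) k B i :=
  tens_mul _ _

theorem siteOp_pauliZ {n : ℕ} (j : Fin n) :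
    siteOp j pauliZ = (-Complex.I) • (majorana (j, 0) * majorana (j, 1)) := by
  rw [majorana_mul]
  refine tens_eq_smul _ _ _ j ?_ fun k hk => ?_
  · ext a b
    fin_cases a <;> fin_cases b <;>
      simp [majoranaFactor, pauliXY, pauliX, pauliY, pauliZ]
  · simp only [majoranaFactor, hk, Function.update_of_ne hk, if_false]
    split_ifs <;> simp [pauliZ_mul_self]

theorem siteOp_pauliX_mul {n : ℕ} {j k : Fin n} (h : (j : ℕ) + 1 = k) :
    siteOp j pauliX * siteOp k pauliX = (-Complex.I) • (majorana (j, 1) * majorana (k, 0)) := by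
  have hjk : j < k := by rw [Fin.lt_def]; omega
  rw [majorana_mul, siteOp_mul_siteOp]
  refine tens_eq_smul _ _ _ j ?_ fun i hi => ?_
  · simp only [majoranaFactor, hjk, hjk.ne, Function.update_self, Function.update_of_ne hjk.ne]
    ext a b
    fin_cases a <;> fin_cases b <;>
      simp [pauliXY, pauliX, pauliY, pauliZ, Matrix.mul_apply]
  · by_cases hik : i = k
    · subst hik
      simp [majoranaFactor, hjk.not_gt, hi, pauliXY]
    · have hlt : i < k ↔ i < j := by
        rw [ne_eq, Fin.ext_iff] at hi
        rw [Fin.ext_iff] at hik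
        simp only [Fin.lt_def]
        omega
      simp only [majoranaFactor, hi, hik, hlt, Function.update_of_ne hi, Function.update_of_ne hik,
        if_false]
      split_ifs <;> simp [pauliZ_mul_self]

theorem siteOp_pauliY_mul {n : ℕ} {j k : Fin n} (h : (j : ℕ) + 1 = k) :
    siteOp j pauliY * siteOp k pauliY = Complex.I • (majorana (j, 0) * majorana (k, 1)) := by
  have hjk : j < k := by rw [Fin.lt_def]; omega
  rw [majorana_mul, siteOp_mul_siteOp]
  refine tens_eq_smul _ _ _ j ?_ fun i hi => ?_
  · simp only [majoranaFactor, hjk, hjk.ne, Function.update_self, Function.update_of_ne hjk.ne]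
    ext a b
    fin_cases a <;> fin_cases b <;>
      simp [pauliXY, pauliX, pauliY, pauliZ, Matrix.mul_apply]
  · by_cases hik : i = k
    · subst hik
      simp [majoranaFactor, hjk.not_gt, hi, pauliXY]
    · have hlt : i < k ↔ i < j := by
        rw [ne_eq, Fin.ext_iff] at hi
        rw [Fin.ext_iff] at hik
        simp only [Fin.lt_def]
        omega
      simp only [majoranaFactor, hi, hik, hlt, Function.update_of_ne hi, Function.update_of_ne hik,
        if_false]
      split_ifs <;> simp [pauliZ_mul_self]

theorem hamiltonian_eq_quadratic (n : ℕ) (μ γ ν : ℕ → ℝ) :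
    hamiltonian n μ γ ν = quadratic (coeff n μ γ ν) := by
  have h1 : quadratic (coeff n μ γ ν) = ∑ j : Fin n, ∑ k : Fin n,
      ((if j = k then (Complex.I * ν j) • (majorana (j, 0) * majorana (k, 1)) else 0)
      + if (j : ℕ) + 1 = k then
          (-(Complex.I * (μ j * (1 - γ j)))) • (majorana (j, 0) * majorana (k, 1))
          + (Complex.I * (μ j * (1 + γ j))) • (majorana (j, 1) * majorana (k, 0)) else 0) := by
    rw [quadratic, Fintype.sum_prod_type]
    refine Finset.sum_congr rfl fun j _ => ?_
    simp only [Fin.sum_univ_two, Fintype.sum_prod_type]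
    rw [← Finset.sum_add_distrib]
    refine Finset.sum_congr rfl fun k _ => ?_
    simp only [coeff, Matrix.of_apply]
    split_ifs with e1 e2 e2
    · exfalso; rw [e1] at e2; omega
    all_goals simp
  rw [h1, hamiltonian]
  simp only [Finset.sum_add_distrib]
  rw [sub_eq_add_neg, add_comm]
  congr 1
  · rw [← Finset.sum_neg_distrib]
    refine Finset.sum_congr rfl fun j _ => ?_
    simp only [Finset.sum_ite_eq, Finset.mem_univ, if_true]
    rw [siteOp_pauliZ, smul_smul, ← neg_smul]
    congr 1
    ring
  · rw [← Finset.sum_neg_distrib]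
    refine Finset.sum_congr rfl fun j _ => ?_
    rw [← Finset.sum_neg_distrib]
    refine Finset.sum_congr rfl fun k _ => ?_
    split_ifs with h
    · rw [siteOp_pauliX_mul h, siteOp_pauliY_mul h, smul_add, smul_smul, smul_smul, smul_smul,
        smul_smul, neg_add, ← neg_smul, ← neg_smul, add_comm]
      congr 2 <;> ring
    · simp

/-- The real skew-symmetric generator of the evolution of the Majorana operators. -/
def generator (n : ℕ) (μ γ ν : ℕ → ℝ) : Matrix (Fin n × Fin 2) (Fin n × Fin 2) ℝ :=
  Matrix.of fun p q =>
    if p.1 = q.1 then !![0, -(2 * ν p.1); 2 * ν p.1, 0] p.2 q.2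
    else if (p.1 : ℕ) + 1 = q.1 then
      !![0, 2 * (μ p.1 * (1 - γ p.1)); -(2 * (μ p.1 * (1 + γ p.1))), 0] p.2 q.2
    else if (q.1 : ℕ) + 1 = p.1 then
      !![0, 2 * (μ q.1 * (1 + γ q.1)); -(2 * (μ q.1 * (1 - γ q.1))), 0] p.2 q.2
    else 0

theorem generator_transpose (n : ℕ) (μ γ ν : ℕ → ℝ) :
    (generator n μ γ ν)ᵀ = -generator n μ γ ν := by
  ext ⟨j, s⟩ ⟨k, t⟩
  simp only [generator, Matrix.transpose_apply, Matrix.neg_apply, Matrix.of_apply]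
  by_cases h : j = k
  · subst h
    fin_cases s <;> fin_cases t <;> simp
  · have h' : ¬ k = j := fun e => h e.symm
    by_cases h1 : (j : ℕ) + 1 = k
    · have h2 : ¬ (k : ℕ) + 1 = j := by omega
      simp only [h, h', h1, h2, if_true, if_false]
      fin_cases s <;> fin_cases t <;> simp
    · simp only [h, h', h1, if_false]
      split_ifs
      · fin_cases s <;> fin_cases t <;> simp
      · simp

theorem generator_eq_coeff (n : ℕ) (μ γ ν : ℕ → ℝ) (p q : Fin n × Fin 2) :
    (generator n μ γ ν p q : ℂ)
      = 2 * Complex.I * (coeff n μ γ ν p q - coeff n μ γ ν q p) := by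
  obtain ⟨j, s⟩ := p
  obtain ⟨k, t⟩ := q
  have hI : ∀ x : ℂ, Complex.I * (Complex.I * x) = -x := fun x => by
    rw [← mul_assoc, Complex.I_mul_I, neg_one_mul]
  simp only [generator, coeff, Matrix.of_apply]
  by_cases h : j = k
  · subst h
    fin_cases s <;> fin_cases t <;> simp [mul_assoc, hI]
  · have h' : ¬ k = j := fun e => h e.symm
    by_cases h1 : (j : ℕ) + 1 = k
    · have h2 : ¬ (k : ℕ) + 1 = j := by omega
      simp only [h, h', h1, h2, if_true, if_false]
      fin_cases s <;> fin_cases t <;> simp [mul_assoc, hI]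
    · simp only [h, h', h1, if_false]
      split_ifs
      · fin_cases s <;> fin_cases t <;> simp [mul_assoc, hI]
      · simp

theorem exp_hamiltonian_mul_field (n : ℕ) (μ γ ν : ℕ → ℝ) (v : Fin n × Fin 2 → ℝ) (t : ℝ) :
    NormedSpace.exp ((Complex.I * (t : ℂ)) • hamiltonian n μ γ ν) * field v
      * NormedSpace.exp ((-(Complex.I * (t : ℂ))) • hamiltonian n μ γ ν)
      = field (NormedSpace.exp (t • generator n μ γ ν) *ᵥ v) := by
  have h := exp_mul_field_mul_exp (Complex.I • hamiltonian n μ γ ν) (generator n μ γ ν)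
    (fun v => by
      rw [hamiltonian_eq_quadratic]
      exact quadratic_commutator _ _ (generator_eq_coeff n μ γ ν) v) v t
  have e1 : (Complex.I * (t : ℂ)) • hamiltonian n μ γ ν = t • Complex.I • hamiltonian n μ γ ν := by
    rw [← Complex.coe_smul, smul_smul, mul_comm]
  rw [← h, neg_smul, e1, smul_neg]

/-! ### The generator and the effective Hamiltonian -/

theorem exp_smul_eq_hermitianFun {ι : Type*} [Fintype ι] [DecidableEq ι] {A : Matrix ι ι ℂ}
    (hA : A.IsHermitian) (c : ℂ) :
    NormedSpace.exp (c • A) = hermitianFun hA fun x => Complex.exp (c * x) := by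
  set U : Matrix ι ι ℂ := (hA.eigenvectorUnitary : Matrix ι ι ℂ) with hU
  have hUU : U * star U = 1 := Unitary.coe_mul_star_self _
  have hinv : U⁻¹ = star U := Matrix.inv_eq_right_inv hUU
  have hunit : IsUnit U := IsUnit.of_mul_eq_one _ hUU
  have hspec : A = U * Matrix.diagonal (fun i => (hA.eigenvalues i : ℂ)) * star U := by
    have := hA.spectral_theorem
    rw [Unitary.conjStarAlgAut_apply] at this
    exact this
  have h1 : c • A = U * Matrix.diagonal (fun i => c * (hA.eigenvalues i : ℂ)) * U⁻¹ := by
    conv_lhs => rw [hspec]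
    rw [hinv, ← smul_mul_assoc, ← mul_smul_comm, ← Matrix.diagonal_smul]
    rfl
  rw [h1, Matrix.exp_conj _ _ hunit, Matrix.exp_diagonal, hinv, hermitianFun]
  congr 3
  funext i
  rw [Pi.coe_exp, Complex.exp_eq_exp_ℂ]

/-- The site-wise change of basis from `(c, c^*)` to Majorana operators. -/
def basisChange (n : ℕ) : Matrix (Fin n × Fin 2) (Fin n × Fin 2) ℂ :=
  Matrix.of fun p q => if p.1 = q.1 then !![1, 1; Complex.I, -Complex.I] p.2 q.2 else 0

theorem basisChange_mul_conjTranspose (n : ℕ) :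
    basisChange n * ((1 / 2 : ℂ) • (basisChange n)ᴴ) = 1 := by
  ext ⟨j, s⟩ ⟨k, t⟩
  rw [Matrix.mul_smul, Matrix.smul_apply, Matrix.mul_apply, Fintype.sum_prod_type]
  simp only [Fin.sum_univ_two, Matrix.conjTranspose_apply, basisChange, Matrix.of_apply,
    Matrix.one_apply, Prod.mk.injEq]
  by_cases h : j = k
  · subst h
    rw [Finset.sum_eq_single j (fun b _ hb => by simp [hb.symm]) (by simp)]
    fin_cases s <;> fin_cases t <;> simp <;> norm_num
  · rw [Finset.sum_eq_zero fun b _ => ?_]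
    · simp [h]
    · by_cases hb : j = b
      · subst hb
        simp [show ¬k = j from fun e => h e.symm]
      · simp [hb]

theorem generator_mul_basisChange (n : ℕ) (μ γ ν : ℕ → ℝ) :
    (generator n μ γ ν).map Complex.ofRealHom * basisChange n
      = basisChange n * ((2 * Complex.I) • effHam n μ γ ν) := by
  ext ⟨j, s⟩ ⟨k, t⟩
  rw [Matrix.mul_apply, Fintype.sum_prod_type, Finset.sum_eq_single k, Matrix.mul_apply,
    Fintype.sum_prod_type, Finset.sum_eq_single j]
  rotate_left
  · intro b _ hb
    simp [basisChange, hb.symm]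
  · simp
  · intro b _ hb
    simp [basisChange, hb]
  · simp
  have hI : ∀ x : ℂ, Complex.I * (Complex.I * x) = -x := fun x => by
    rw [← mul_assoc, Complex.I_mul_I, neg_one_mul]
  simp only [Fin.sum_univ_two, basisChange, Matrix.of_apply, if_true, Matrix.smul_apply,
    Matrix.map_apply, effHam, generator]
  by_cases h : j = k
  · subst h
    fin_cases s <;> fin_cases t <;> simp [pauliZ] <;> ring_nf <;> simp
  · by_cases h1 : (j : ℕ) + 1 = k
    · simp only [h, h1, if_true, if_false]
      fin_cases s <;> fin_cases t <;>
        simp [blockS, mul_assoc, mul_left_comm _ Complex.I, hI] <;> ring_nf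
    · simp only [h, h1, if_false]
      split_ifs
      · fin_cases s <;> fin_cases t <;>
          simp [blockS, mul_assoc, mul_left_comm _ Complex.I, hI] <;> ring_nf
      · simp

theorem exp_generator_map (n : ℕ) (μ γ ν : ℕ → ℝ) (t : ℝ) :
    (NormedSpace.exp (t • generator n μ γ ν)).map Complex.ofRealHom
      = basisChange n
        * hermitianFun (effHam_isHermitian n μ γ ν) (fun x => Complex.exp (2 * Complex.I * t * x))
        * ((1 / 2 : ℂ) • (basisChange n)ᴴ) := by
  have hU := basisChange_mul_conjTranspose n
  have hinv : (basisChange n)⁻¹ = (1 / 2 : ℂ) • (basisChange n)ᴴ := Matrix.inv_eq_right_inv hU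
  have hunit : IsUnit (basisChange n) := IsUnit.of_mul_eq_one _ hU
  rw [← exp_smul_eq_hermitianFun, ← hinv, ← Matrix.exp_conj _ _ hunit]
  have h1 : basisChange n * ((2 * Complex.I * t) • effHam n μ γ ν) * (basisChange n)⁻¹
      = (t • generator n μ γ ν).map Complex.ofRealHom := by
    have h2 : (2 * Complex.I * t) • effHam n μ γ ν
        = (t : ℂ) • ((2 * Complex.I) • effHam n μ γ ν) := by
      rw [smul_smul, mul_comm]
    rw [h2, mul_smul_comm, ← generator_mul_basisChange, smul_mul_assoc, mul_assoc, hinv, hU,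
      mul_one]
    ext p q
    simp
  rw [h1]
  open scoped Matrix.Norms.Operator in
  exact NormedSpace.map_exp (Complex.ofRealHom.mapMatrix (m := Fin n × Fin 2))
    (continuous_id.matrix_map Complex.continuous_ofReal) _

theorem norm_apply_le_norm_toEuclideanCLM (A : Matrix (Fin 2) (Fin 2) ℂ) (s t : Fin 2) :
    ‖A s t‖ ≤ ‖Matrix.toEuclideanCLM (n := Fin 2) (𝕜 := ℂ) A‖ := by
  have h1 := (Matrix.toEuclideanCLM (n := Fin 2) (𝕜 := ℂ) A).le_opNorm (EuclideanSpace.single t 1)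
  have h2 := PiLp.norm_apply_le
    (Matrix.toEuclideanCLM (n := Fin 2) (𝕜 := ℂ) A (EuclideanSpace.single t 1)) s
  have h3 : (Matrix.toEuclideanCLM (n := Fin 2) (𝕜 := ℂ) A (EuclideanSpace.single t 1)) s
      = A s t := by
    rw [Matrix.ofLp_toEuclideanCLM]
    simp
  rw [h3] at h2
  refine h2.trans (h1.trans (le_of_eq ?_))
  simp

theorem abs_exp_generator_le (n : ℕ) (μ γ ν : ℕ → ℝ) (t : ℝ) (p q : Fin n × Fin 2) :
    ENNReal.ofReal |NormedSpace.exp (t • generator n μ γ ν) p q|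
      ≤ 2 * eigencorrelator n μ γ ν p.1 q.1 := by
  set g : ℝ → ℂ := fun x => Complex.exp (2 * Complex.I * t * x) with hg
  have hgm : Measurable g := by
    refine Continuous.measurable ?_
    simp only [hg]
    fun_prop
  have hg1 : ∀ x, ‖g x‖ ≤ 1 := fun x => by
    simp [hg, Complex.norm_exp]
  set F := hermitianFun (effHam_isHermitian n μ γ ν) g with hF
  set N := ‖Matrix.toEuclideanCLM (n := Fin 2) (𝕜 := ℂ) (block F p.1 q.1)‖ with hN
  have hle : ENNReal.ofReal N ≤ eigencorrelator n μ γ ν p.1 q.1 :=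
    le_iSup (fun g : {g : ℝ → ℂ // Measurable g ∧ ∀ x, ‖g x‖ ≤ 1} =>
      ENNReal.ofReal ‖Matrix.toEuclideanCLM (n := Fin 2) (𝕜 := ℂ)
        (block (hermitianFun (effHam_isHermitian n μ γ ν) g.1) p.1 q.1)‖) ⟨g, hgm, hg1⟩
  have hent : ∀ s t, ‖F (p.1, s) (q.1, t)‖ ≤ N := fun s t =>
    norm_apply_le_norm_toEuclideanCLM (block F p.1 q.1) s t
  have habs : |NormedSpace.exp (t • generator n μ γ ν) p q| ≤ 2 * N := by
    have h1 := congrFun (congrFun (exp_generator_map n μ γ ν t) p) q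
    rw [← hg, ← hF] at h1
    have hu : ∀ (a b : Fin 2), ‖(!![1, 1; Complex.I, -Complex.I] : Matrix (Fin 2) (Fin 2) ℂ) a b‖ = 1 := by
      intro a b
      fin_cases a <;> fin_cases b <;> simp
    have h2 : ((NormedSpace.exp (t • generator n μ γ ν)).map Complex.ofRealHom) p q
        = ∑ b, (∑ a, (!![1, 1; Complex.I, -Complex.I] : Matrix (Fin 2) (Fin 2) ℂ) p.2 a
            * F (p.1, a) (q.1, b))
          * ((1 / 2 : ℂ) * star ((!![1, 1; Complex.I, -Complex.I] : Matrix (Fin 2) (Fin 2) ℂ) q.2 b)) := by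
      rw [h1, Matrix.mul_apply, Fintype.sum_prod_type, Finset.sum_eq_single q.1]
      · refine Finset.sum_congr rfl fun b _ => ?_
        congr 1
        · rw [Matrix.mul_apply, Fintype.sum_prod_type, Finset.sum_eq_single p.1]
          · simp [basisChange]
          · intro c _ hc
            simp [basisChange, hc.symm]
          · simp
        · simp [basisChange]
      · intro c _ hc
        simp [basisChange, hc.symm]
      · simp
    have h3 : |NormedSpace.exp (t • generator n μ γ ν) p q|
        = ‖((NormedSpace.exp (t • generator n μ γ ν)).map Complex.ofRealHom) p q‖ := by
      simp
    rw [h3, h2]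
    refine (norm_sum_le _ _).trans ?_
    have h4 : ∀ b : Fin 2, ‖(∑ a, (!![1, 1; Complex.I, -Complex.I] : Matrix (Fin 2) (Fin 2) ℂ) p.2 a
            * F (p.1, a) (q.1, b))
          * ((1 / 2 : ℂ) * star ((!![1, 1; Complex.I, -Complex.I] : Matrix (Fin 2) (Fin 2) ℂ) q.2 b))‖
        ≤ N := by
      intro b
      rw [norm_mul, norm_mul, norm_star, hu, mul_one]
      have h5 : ‖∑ a, (!![1, 1; Complex.I, -Complex.I] : Matrix (Fin 2) (Fin 2) ℂ) p.2 a
            * F (p.1, a) (q.1, b)‖ ≤ ∑ a : Fin 2, N :=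
        (norm_sum_le _ _).trans (Finset.sum_le_sum fun a _ => by
          rw [norm_mul, hu, one_mul]
          exact hent a b)
      have h6 : ‖(1 / 2 : ℂ)‖ = 1 / 2 := by simp
      rw [h6]
      simp only [Finset.sum_const, Finset.card_univ, Fintype.card_fin, nsmul_eq_mul] at h5
      push_cast at h5
      linarith
    refine (Finset.sum_le_sum fun b _ => h4 b).trans ?_
    simp
  calc ENNReal.ofReal |NormedSpace.exp (t • generator n μ γ ν) p q|
      ≤ ENNReal.ofReal (2 * N) := ENNReal.ofReal_le_ofReal habs
    _ = 2 * ENNReal.ofReal N := by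
        rw [ENNReal.ofReal_mul two_pos.le, ENNReal.ofReal_ofNat]
    _ ≤ _ := by gcongr

theorem exp_generator_transpose_mul (n : ℕ) (μ γ ν : ℕ → ℝ) (t : ℝ) :
    (NormedSpace.exp (t • generator n μ γ ν))ᵀ * NormedSpace.exp (t • generator n μ γ ν) = 1 := by
  rw [← Matrix.exp_transpose, Matrix.transpose_smul, generator_transpose, smul_neg,
    ← Matrix.exp_add_of_commute _ _ (Commute.refl (t • generator n μ γ ν)).neg_left,
    neg_add_cancel, NormedSpace.exp_zero]

theorem abs_apply_le_one_of_orthogonal {m : Type*} [Fintype m] [DecidableEq m] {O : Matrix m m ℝ}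
    (hO : Oᵀ * O = 1) (p q : m) : |O p q| ≤ 1 := by
  have h := congrFun (congrFun hO q) q
  rw [Matrix.mul_apply, Matrix.one_apply_eq] at h
  have h1 : O p q * O p q ≤ 1 := by
    rw [← h]
    exact Finset.single_le_sum (f := fun p => Oᵀ q p * O p q)
      (fun i _ => mul_self_nonneg (O i q)) (Finset.mem_univ p)
  exact abs_le_one_iff_mul_self_le_one.2 h1

/-! ### Covariance of the evolved product states -/

theorem upDown_apply {n : ℕ} (α x : Fin n → Fin 2) :
    upDown α x = if x = fun j => Fin.rev (α j) then 1 else 0 := by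
  have h1 : ∀ a b : Fin 2, spinVec a b = if b = Fin.rev a then 1 else 0 := by
    intro a b
    fin_cases a <;> fin_cases b <;> simp [spinVec, Fin.rev]
  simp only [upDown, h1]
  split_ifs with h
  · simp [h]
  · obtain ⟨j, hj⟩ := Function.ne_iff.1 h
    exact Finset.prod_eq_zero (Finset.mem_univ j) (by simp [hj])

theorem trace_pureState_upDown_mul {n : ℕ} (α : Fin n → Fin 2)
    (X : Matrix (Fin n → Fin 2) (Fin n → Fin 2) ℂ) :
    (pureState (upDown α) * X).trace = X (fun j => Fin.rev (α j)) fun j => Fin.rev (α j) := by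
  simp [Matrix.trace, Matrix.mul_apply, pureState, Matrix.vecMulVec_apply, upDown_apply]

/-- The covariance matrix of the Majorana operators in the spin configuration `x`. -/
def productCovariance {ι : Type*} [DecidableEq ι] (x : ι → Fin 2) :
    Matrix (ι × Fin 2) (ι × Fin 2) ℝ :=
  Matrix.of fun p q =>
    if p.1 = q.1 then !![0, spinSign (x p.1); -spinSign (x p.1), 0] p.2 q.2 else 0

section productCovariance

variable {ι : Type*}

theorem productCovariance_transpose [DecidableEq ι] (x : ι → Fin 2) :
    (productCovariance x)ᵀ = -productCovariance x := by
  ext ⟨j, s⟩ ⟨k, t⟩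
  simp only [productCovariance, Matrix.transpose_apply, Matrix.neg_apply, Matrix.of_apply]
  by_cases h : j = k
  · subst h
    fin_cases s <;> fin_cases t <;> simp
  · simp [h, show ¬k = j from fun e => h e.symm]

variable [Fintype ι]

theorem productCovariance_mul_self [DecidableEq ι] (x : ι → Fin 2) :
    productCovariance x * productCovariance x = -1 := by
  ext ⟨j, s⟩ ⟨k, t⟩
  rw [Matrix.mul_apply, Fintype.sum_prod_type, Finset.sum_eq_single j]
  · simp only [productCovariance, Matrix.of_apply, Fin.sum_univ_two, Matrix.neg_apply,
      Matrix.one_apply, Prod.mk.injEq]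
    by_cases h : j = k
    · subst h
      fin_cases s <;> fin_cases t <;> simp [spinSign_mul_self]
    · simp [h]
  · intro b _ hb
    simp [productCovariance, hb.symm]
  · simp

theorem majorana_mul_majorana_apply_self [LinearOrder ι] (x : ι → Fin 2) (p q : ι × Fin 2) :
    (majorana p * majorana q) x x
      = (if p = q then 1 else 0) + Complex.I * (productCovariance x p q : ℂ) := by
  by_cases hpq : p = q
  · subst hpq
    obtain ⟨j, s⟩ := p
    rw [majorana_mul_self]
    fin_cases s <;> simp [productCovariance]
  rw [majorana_mul, tens, Matrix.of_apply, if_neg hpq, zero_add]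
  obtain ⟨j, s⟩ := p
  obtain ⟨k, t⟩ := q
  have hoff : ∀ (s a : Fin 2), (pauliXY s * pauliZ) a a = 0 ∧ (pauliZ * pauliXY s) a a = 0
      ∧ pauliXY s a a = 0 := by
    intro s a
    fin_cases s <;> fin_cases a <;>
      simp [pauliXY, pauliX, pauliY, pauliZ, Matrix.mul_apply]
  rcases lt_trichotomy j k with h | h | h
  · rw [Finset.prod_eq_zero (Finset.mem_univ j)]
    · simp [productCovariance, h.ne]
    · simpa [majoranaFactor, h] using (hoff s (x j)).1
  · subst h
    have hst : s ≠ t := fun e => hpq (by rw [e])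
    rw [Finset.prod_eq_single j]
    · simp only [majoranaFactor, lt_irrefl, if_false, if_true, productCovariance, Matrix.of_apply]
      generalize x j = a
      fin_cases s <;> fin_cases t <;> (try exact absurd rfl hst) <;> fin_cases a <;>
        simp [pauliXY, pauliX, pauliY, spinSign, Matrix.mul_apply]
    · intro i _ hi
      simp only [majoranaFactor, hi, if_false]
      split_ifs <;> simp [pauliZ_mul_self]
    · simp
  · rw [Finset.prod_eq_zero (Finset.mem_univ k)]
    · simp [productCovariance, h.ne']
    · simpa [majoranaFactor, h] using (hoff t (x k)).2.1

theorem field_mul_field_apply_self [LinearOrder ι] (x : ι → Fin 2) (v w : ι × Fin 2 → ℝ) :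
    (field v * field w) x x
      = ((v ⬝ᵥ w : ℝ) : ℂ) + Complex.I * ((v ⬝ᵥ productCovariance x *ᵥ w : ℝ) : ℂ) := by
  rw [field_mul]
  simp only [Matrix.sum_apply, Matrix.smul_apply, majorana_mul_majorana_apply_self, smul_eq_mul,
    mul_add, Finset.sum_add_distrib]
  congr 1
  · simp [dotProduct]
  · simp only [dotProduct, Matrix.mulVec, Complex.ofReal_sum, Complex.ofReal_mul, Finset.mul_sum]
    exact Finset.sum_congr rfl fun p _ => Finset.sum_congr rfl fun q _ => by ring

end productCovariance

theorem field_single {ι : Type*} [Fintype ι] [LinearOrder ι] (p : ι × Fin 2) :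
    field (Pi.single p 1) = majorana p := by
  rw [field, Finset.sum_eq_single p]
  · simp
  · intro q _ hq
    simp [hq]
  · simp

theorem exp_smul_mul_exp_neg_smul {ι : Type*} [Fintype ι] [DecidableEq ι] (H : Matrix ι ι ℂ)
    (c : ℂ) : NormedSpace.exp (c • H) * NormedSpace.exp ((-c) • H) = 1 := by
  rw [neg_smul, ← Matrix.exp_add_of_commute _ _ (Commute.refl (c • H)).neg_right, add_neg_cancel,
    NormedSpace.exp_zero]

/-- The covariance matrix of the evolved spin configuration `x`. -/
def evolvedCovariance (n : ℕ) (μ γ ν : ℕ → ℝ) (t : ℝ) (x : Fin n → Fin 2) :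
    Matrix (Fin n × Fin 2) (Fin n × Fin 2) ℝ :=
  (NormedSpace.exp (t • generator n μ γ ν))ᵀ * productCovariance x
    * NormedSpace.exp (t • generator n μ γ ν)

theorem evolvedCovariance_transpose (n : ℕ) (μ γ ν : ℕ → ℝ) (t : ℝ) (x : Fin n → Fin 2) :
    (evolvedCovariance n μ γ ν t x)ᵀ = -evolvedCovariance n μ γ ν t x := by
  simp only [evolvedCovariance, Matrix.transpose_mul, Matrix.transpose_transpose,
    productCovariance_transpose, Matrix.neg_mul, Matrix.mul_neg, Matrix.mul_assoc]

theorem evolvedCovariance_mul_self (n : ℕ) (μ γ ν : ℕ → ℝ) (t : ℝ) (x : Fin n → Fin 2) :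
    evolvedCovariance n μ γ ν t x * evolvedCovariance n μ γ ν t x = -1 := by
  have h := exp_generator_transpose_mul n μ γ ν t
  have h' := mul_eq_one_comm.1 h
  rw [evolvedCovariance]
  set O := NormedSpace.exp (t • generator n μ γ ν)
  calc _ = Oᵀ * productCovariance x * (O * Oᵀ) * productCovariance x * O := by
        simp only [Matrix.mul_assoc]
    _ = _ := by
        rw [h', Matrix.mul_one, Matrix.mul_assoc Oᵀ, productCovariance_mul_self, Matrix.mul_neg,
          Matrix.mul_one, Matrix.neg_mul, h]

theorem trace_evolve_mul (n : ℕ) (μ γ ν : ℕ → ℝ) (t : ℝ) (α : Fin n → Fin 2)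
    (p q : Fin n × Fin 2) :
    (evolve (hamiltonian n μ γ ν) t (pureState (upDown α)) * (majorana p * majorana q)).trace
      = (if p = q then 1 else 0)
        + Complex.I * (evolvedCovariance n μ γ ν t (fun j => Fin.rev (α j)) p q : ℂ) := by
  have h0 := exp_smul_mul_exp_neg_smul (hamiltonian n μ γ ν) (-(Complex.I * (t : ℂ)))
  rw [neg_neg] at h0
  have hp := exp_hamiltonian_mul_field n μ γ ν (Pi.single p 1) t
  have hq := exp_hamiltonian_mul_field n μ γ ν (Pi.single q 1) t
  rw [field_single] at hp hq
  have hcov := (trace_pureState_upDown_mul α _).trans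
    (field_mul_field_apply_self (fun j => Fin.rev (α j))
      (NormedSpace.exp (t • generator n μ γ ν) *ᵥ Pi.single p 1)
      (NormedSpace.exp (t • generator n μ γ ν) *ᵥ Pi.single q 1))
  rw [← hp, ← hq] at hcov
  set Em := NormedSpace.exp ((-(Complex.I * (t : ℂ))) • hamiltonian n μ γ ν)
  set Ep := NormedSpace.exp ((Complex.I * (t : ℂ)) • hamiltonian n μ γ ν)
  have h1 : (evolve (hamiltonian n μ γ ν) t (pureState (upDown α)) * (majorana p * majorana q)).trace
      = (pureState (upDown α) * ((Ep * majorana p * Em) * (Ep * majorana q * Em))).trace := by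
    have h2 : (Ep * majorana p * Em) * (Ep * majorana q * Em)
        = Ep * (majorana p * majorana q) * Em := by
      calc _ = Ep * majorana p * (Em * Ep) * majorana q * Em := by simp only [Matrix.mul_assoc]
        _ = _ := by rw [h0, Matrix.mul_one]; simp only [Matrix.mul_assoc]
    rw [h2, evolve]
    change (Em * pureState (upDown α) * Ep * (majorana p * majorana q)).trace = _
    rw [Matrix.mul_assoc, Matrix.mul_assoc Em, Matrix.trace_mul_comm]
    simp only [Matrix.mul_assoc]
  rw [h1, hcov]
  have hO := exp_generator_transpose_mul n μ γ ν t
  set O := NormedSpace.exp (t • generator n μ γ ν)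
  have e1 : (O *ᵥ Pi.single p 1) ⬝ᵥ (O *ᵥ Pi.single q 1) = if p = q then 1 else 0 := by
    rw [Matrix.mulVec_single_one, Matrix.mulVec_single_one]
    have := congrFun (congrFun hO p) q
    rw [Matrix.one_apply] at this
    exact this
  have e2 : (O *ᵥ Pi.single p 1) ⬝ᵥ productCovariance (fun j => Fin.rev (α j)) *ᵥ
      (O *ᵥ Pi.single q 1) = evolvedCovariance n μ γ ν t (fun j => Fin.rev (α j)) p q := by
    rw [Matrix.mulVec_single_one, Matrix.mulVec_single_one, evolvedCovariance, Matrix.mul_assoc]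
    rfl
  rw [e1, e2]
  split_ifs <;> simp

/-! ### The reduced state -/

theorem quadratic_isHermitian {ι : Type*} [Fintype ι] [LinearOrder ι]
    (G : Matrix (ι × Fin 2) (ι × Fin 2) ℂ) (hG : ∀ p q, star (G p q) = -G p q)
    (hG0 : ∀ p, G p p = 0) : (quadratic G)ᴴ = quadratic G := by
  simp only [quadratic, Matrix.conjTranspose_sum, Matrix.conjTranspose_smul,
    Matrix.conjTranspose_mul, majorana_conjTranspose]
  refine Finset.sum_congr rfl fun p _ => Finset.sum_congr rfl fun q _ => ?_
  by_cases h : p = q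
  · rw [h, hG0]; simp
  · rw [majorana_anticomm (Ne.symm h), hG, smul_smul]
    simp

theorem hamiltonian_conjTranspose (n : ℕ) (μ γ ν : ℕ → ℝ) :
    (hamiltonian n μ γ ν)ᴴ = hamiltonian n μ γ ν := by
  rw [hamiltonian_eq_quadratic]
  refine quadratic_isHermitian _ ?_ ?_
  · rintro ⟨j, s⟩ ⟨k, t⟩
    simp only [coeff, Matrix.of_apply, star_add, neg_add]
    congr 1
    · split_ifs
      · fin_cases s <;> fin_cases t <;> simp
      · simp
    · split_ifs
      · fin_cases s <;> fin_cases t <;> simp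
      · simp
  · rintro ⟨j, s⟩
    fin_cases s <;> simp [coeff]

open scoped ComplexOrder in
theorem evolve_posSemidef {ι : Type*} [Fintype ι] [DecidableEq ι] {H ρ : Matrix ι ι ℂ}
    (hH : Hᴴ = H) (hρ : ρ.PosSemidef) (t : ℝ) : (evolve H t ρ).PosSemidef := by
  have h : NormedSpace.exp ((Complex.I * (t : ℂ)) • H)
      = (NormedSpace.exp ((-(Complex.I * (t : ℂ))) • H))ᴴ := by
    rw [← Matrix.exp_conjTranspose, Matrix.conjTranspose_smul, hH]
    simp
  rw [evolve, h]
  exact hρ.mul_mul_conjTranspose_same _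

theorem trace_evolve {ι : Type*} [Fintype ι] [DecidableEq ι] (H ρ : Matrix ι ι ℂ) (t : ℝ) :
    (evolve H t ρ).trace = ρ.trace := by
  rw [evolve, Matrix.trace_mul_cycle, exp_smul_mul_exp_neg_smul, Matrix.one_mul]

section reduced

variable {n : ℕ} (S : Finset (Fin n))

open scoped ComplexOrder in
theorem reducedState_posSemidef {ρ : Matrix (Fin n → Fin 2) (Fin n → Fin 2) ℂ}
    (hρ : ρ.PosSemidef) : (reducedState S ρ).PosSemidef := by
  have h : reducedState S ρ = ∑ z, ρ.submatrix (fun x => glue S x z) (fun x => glue S x z) := by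
    ext x y
    simp [reducedState, Matrix.sum_apply]
  rw [h]
  exact Matrix.posSemidef_sum _ fun z _ => hρ.submatrix _

theorem glue_apply_of_mem (x : {j // j ∈ S} → Fin 2) (z : {j // j ∉ S} → Fin 2) (j : {j // j ∈ S}) :
    glue S x z j = x j := by
  simp [glue]

theorem glue_apply_of_notMem (x : {j // j ∈ S} → Fin 2) (z : {j // j ∉ S} → Fin 2)
    (j : {j // j ∉ S}) : glue S x z j = z j := by
  simp [glue, j.2]

theorem sum_glue {M : Type*} [AddCommMonoid M] (f : (Fin n → Fin 2) → M) :
    ∑ x, f x = ∑ x, ∑ z, f (glue S x z) := by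
  rw [← (Equiv.piEquivPiSubtypeProd (fun j => j ∈ S) (fun _ => Fin 2)).symm.sum_comp,
    Fintype.sum_prod_type]
  rfl

theorem trace_reducedState_mul_tens (ρ : Matrix (Fin n → Fin 2) (Fin n → Fin 2) ℂ)
    (F : Fin n → Matrix (Fin 2) (Fin 2) ℂ) (hF : ∀ j, j ∉ S → F j = 1) :
    (reducedState S ρ * tens fun j : {j // j ∈ S} => F j).trace = (ρ * tens F).trace := by
  have hT : ∀ x y z w, tens F (glue S y w) (glue S x z)
      = tens (fun j : {j // j ∈ S} => F j) y x * if w = z then 1 else 0 := by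
    intro x y z w
    simp only [tens, Matrix.of_apply]
    rw [← Fintype.prod_subtype_mul_prod_subtype (fun j => j ∈ S)]
    congr 1
    · refine Finset.prod_congr (Finset.ext fun _ => by simp only [Finset.mem_univ]) fun j _ => ?_
      rw [glue_apply_of_mem, glue_apply_of_mem]
    · have h2 := congrFun (congrFun (tens_one (ι := {j // j ∉ S})) w) z
      rw [tens, Matrix.of_apply, Matrix.one_apply] at h2
      rw [← h2]
      refine Finset.prod_congr (Finset.ext fun _ => by simp only [Finset.mem_univ]) fun j _ => ?_
      rw [hF j j.2, glue_apply_of_notMem, glue_apply_of_notMem]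
  have hL : (reducedState S ρ * tens fun j : {j // j ∈ S} => F j).trace
      = ∑ x, ∑ y, ∑ z, ρ (glue S x z) (glue S y z)
        * tens (fun j : {j // j ∈ S} => F j) y x := by
    simp only [Matrix.trace, Matrix.diag_apply, Matrix.mul_apply, reducedState, Matrix.of_apply,
      Finset.sum_mul]
  have hR : (ρ * tens F).trace = ∑ x, ∑ z, ∑ y, ∑ w, ρ (glue S x z) (glue S y w)
        * tens F (glue S y w) (glue S x z) := by
    simp only [Matrix.trace, Matrix.diag_apply, Matrix.mul_apply]
    rw [sum_glue S]
    exact Finset.sum_congr rfl fun x _ => Finset.sum_congr rfl fun z _ => sum_glue S _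
  rw [hL, hR]
  refine Finset.sum_congr rfl fun x _ => ?_
  rw [Finset.sum_comm]
  refine Finset.sum_congr rfl fun z _ => Finset.sum_congr rfl fun y _ => ?_
  simp [hT]

theorem trace_reducedState (ρ : Matrix (Fin n → Fin 2) (Fin n → Fin 2) ℂ) :
    (reducedState S ρ).trace = ρ.trace := by
  have h := trace_reducedState_mul_tens S ρ (fun _ => 1) fun _ _ => rfl
  simpa [tens_one] using h

theorem trace_reducedState_Icc_mul (a b : Fin n) (ρ : Matrix (Fin n → Fin 2) (Fin n → Fin 2) ℂ)
    (p q : {j // j ∈ Finset.Icc a b} × Fin 2) :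
    (reducedState (Finset.Icc a b) ρ * (majorana p * majorana q)).trace
      = (ρ * (majorana ((p.1 : Fin n), p.2) * majorana ((q.1 : Fin n), q.2))).trace := by
  rw [majorana_mul ((p.1 : Fin n), p.2), ← trace_reducedState_mul_tens (Finset.Icc a b)]
  · refine congrArg (fun X => (reducedState (Finset.Icc a b) ρ * X).trace)
      ((majorana_mul p q).trans ?_)
    congr 1
    funext j
    simp only [majoranaFactor, Subtype.ext_iff]
    rfl
  · intro j hj
    have hp := Finset.mem_Icc.1 p.1.2
    have hq := Finset.mem_Icc.1 q.1.2
    rw [Finset.mem_Icc, not_and_or, not_le, not_le] at hj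
    rcases hj with hj | hj
    · simp [majoranaFactor, hj.trans_le hp.1, hj.trans_le hq.1, pauliZ_mul_self]
    · have h1 := hp.2.trans_lt hj
      have h2 := hq.2.trans_lt hj
      simp [majoranaFactor, h1.not_gt, h2.not_gt, h1.ne', h2.ne']

end reduced

/-! ### Deterministic entanglement bound -/

open scoped ComplexOrder in
theorem entanglement_le_sum_covariance (n : ℕ) (μ γ ν : ℕ → ℝ) (t : ℝ) (α : Fin n → Fin 2)
    (a b : Fin n) :
    entanglement (Finset.Icc a b) (evolve (hamiltonian n μ γ ν) t (pureState (upDown α)))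
      ≤ 2 * ∑ q : {j // j ∉ Finset.Icc a b} × Fin 2, ∑ p : {j // j ∈ Finset.Icc a b} × Fin 2,
        |evolvedCovariance n μ γ ν t (fun j => Fin.rev (α j))
          ((q.1 : Fin n), q.2) ((p.1 : Fin n), p.2)| := by
  set ρ := evolve (hamiltonian n μ γ ν) t (pureState (upDown α)) with hρ
  set A := evolvedCovariance n μ γ ν t (fun j => Fin.rev (α j)) with hA
  have hAt : Aᵀ = -A := evolvedCovariance_transpose _ _ _ _ _ _
  have hpsd := reducedState_posSemidef (Finset.Icc a b)
    (evolve_posSemidef (hamiltonian_conjTranspose n μ γ ν)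
      (Matrix.posSemidef_vecMulVec_self_star (upDown α)) t)
  have htr : (reducedState (Finset.Icc a b) ρ).trace = 1 := by
    rw [trace_reducedState, hρ, trace_evolve, ← Matrix.mul_one (pureState _),
      trace_pureState_upDown_mul, Matrix.one_apply_eq]
  let f : {j // j ∈ Finset.Icc a b} × Fin 2 → Fin n × Fin 2 := fun p => ((p.1 : Fin n), p.2)
  let g : {j // j ∉ Finset.Icc a b} × Fin 2 → Fin n × Fin 2 := fun p => ((p.1 : Fin n), p.2)
  have hf : Function.Injective f := fun p q h =>
    Prod.ext (Subtype.ext (congrArg Prod.fst h)) (congrArg (fun r : Fin n × Fin 2 => r.2) h)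
  refine entropy_le_of_covariance hpsd htr (A.submatrix f f) ?_ ?_ (A.submatrix g f) ?_
  · rw [Matrix.transpose_submatrix, hAt]
    rfl
  · intro p q
    refine (trace_reducedState_Icc_mul a b ρ p q).trans ((trace_evolve_mul n μ γ ν t α _ _).trans ?_)
    have : (((p.1 : Fin n), p.2) = ((q.1 : Fin n), q.2)) ↔ p = q := hf.eq_iff
    simp only [this]
    rfl
  · ext p q
    have h1 : (A * A) (f p) (f q) = -(1 : Matrix (Fin n × Fin 2) (Fin n × Fin 2) ℝ) (f p) (f q) :=
      congrFun (congrFun (evolvedCovariance_mul_self n μ γ ν t _) (f p)) (f q)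
    have h2 : (A * A) (f p) (f q) = ∑ r, A (f p) (f r) * A (f r) (f q)
        + ∑ r, A (f p) (g r) * A (g r) (f q) := by
      rw [Matrix.mul_apply, Fintype.sum_prod_type,
        ← Fintype.sum_subtype_add_sum_subtype (fun j => j ∈ Finset.Icc a b)]
      rw [Fintype.sum_prod_type, Fintype.sum_prod_type]
      congr 1
      exact Finset.sum_congr (Finset.ext fun _ => by simp only [Finset.mem_univ]) fun _ _ => rfl
    have h3 : ∀ r, A (g r) (f p) = -A (f p) (g r) := fun r =>
      congrFun (congrFun hAt (f p)) (g r)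
    have h4 : (1 : Matrix (Fin n × Fin 2) (Fin n × Fin 2) ℝ) (f p) (f q)
        = (1 : Matrix ({j // j ∈ Finset.Icc a b} × Fin 2) _ ℝ) p q := by
      rw [Matrix.one_apply, Matrix.one_apply]
      simp only [hf.eq_iff]
    simp only [Matrix.mul_apply, Matrix.add_apply, Matrix.transpose_apply, Matrix.submatrix_apply,
      h3, neg_mul, Finset.sum_neg_distrib]
    rw [h4, h2] at h1
    have h5 : -∑ r, A (f p) (g r) * A (g r) (f q)
        = (1 : Matrix ({j // j ∈ Finset.Icc a b} × Fin 2) _ ℝ) p q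
          + ∑ r, A (f p) (f r) * A (f r) (f q) := by
      linarith
    exact h5

/-- The sum of the absolute values of the entries of the `(l, j)` block of the evolution of the
Majorana operators. -/
def propagator (n : ℕ) (μ γ ν : ℕ → ℝ) (t : ℝ) (l j : Fin n) : ℝ :=
  ∑ s : Fin 2, ∑ s' : Fin 2, |NormedSpace.exp (t • generator n μ γ ν) (l, s) (j, s')|

theorem sum_abs_evolvedCovariance_le (n : ℕ) (μ γ ν : ℕ → ℝ) (t : ℝ) (x : Fin n → Fin 2)
    (j k : Fin n) :
    ∑ s : Fin 2, ∑ s' : Fin 2, |evolvedCovariance n μ γ ν t x (j, s) (k, s')|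
      ≤ ∑ l, propagator n μ γ ν t l j * propagator n μ γ ν t l k := by
  set O := NormedSpace.exp (t • generator n μ γ ν) with hO
  have h1 : ∀ s s', |evolvedCovariance n μ γ ν t x (j, s) (k, s')|
      ≤ ∑ l, (|O (l, 0) (j, s)| + |O (l, 1) (j, s)|) * (|O (l, 0) (k, s')| + |O (l, 1) (k, s')|) := by
    intro s s'
    have h2 : evolvedCovariance n μ γ ν t x (j, s) (k, s')
        = ∑ l, spinSign (x l) * (O (l, 0) (j, s) * O (l, 1) (k, s')
            - O (l, 1) (j, s) * O (l, 0) (k, s')) := by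
      rw [evolvedCovariance, Matrix.mul_assoc, Matrix.mul_apply, Fintype.sum_prod_type]
      refine Finset.sum_congr rfl fun l _ => ?_
      have h3 : ∀ c, (productCovariance x * O) (l, c) (k, s')
          = ∑ d, !![0, spinSign (x l); -spinSign (x l), 0] c d * O (l, d) (k, s') := by
        intro c
        rw [Matrix.mul_apply, Fintype.sum_prod_type, Finset.sum_eq_single l]
        · simp [productCovariance]
        · intro m _ hm
          simp [productCovariance, hm.symm]
        · simp
      rw [← hO]
      simp only [h3, Fin.sum_univ_two, Matrix.transpose_apply]
      simp
      ring
    rw [h2]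
    refine (Finset.abs_sum_le_sum_abs _ _).trans (Finset.sum_le_sum fun l _ => ?_)
    have h4 : |spinSign (x l)| = 1 := by
      unfold spinSign; split_ifs <;> simp
    rw [abs_mul, h4, one_mul]
    refine (abs_sub _ _).trans ?_
    rw [abs_mul, abs_mul]
    have e1 := mul_nonneg (abs_nonneg (O (l, 0) (j, s))) (abs_nonneg (O (l, 0) (k, s')))
    have e2 := mul_nonneg (abs_nonneg (O (l, 1) (j, s))) (abs_nonneg (O (l, 1) (k, s')))
    nlinarith
  refine (Finset.sum_le_sum fun s _ => Finset.sum_le_sum fun s' _ => h1 s s').trans (le_of_eq ?_)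
  simp only [propagator, ← hO, Fin.sum_univ_two, ← Finset.sum_add_distrib]
  exact Finset.sum_congr rfl fun l _ => by ring

theorem entanglement_le_sum_propagator (n : ℕ) (μ γ ν : ℕ → ℝ) (t : ℝ) (α : Fin n → Fin 2)
    (a b : Fin n) :
    entanglement (Finset.Icc a b) (evolve (hamiltonian n μ γ ν) t (pureState (upDown α)))
      ≤ 2 * ∑ j ∈ (Finset.Icc a b)ᶜ, ∑ k ∈ Finset.Icc a b, ∑ l,
          propagator n μ γ ν t l j * propagator n μ γ ν t l k := by
  refine (entanglement_le_sum_covariance n μ γ ν t α a b).trans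
    (mul_le_mul_of_nonneg_left ?_ two_pos.le)
  set A := evolvedCovariance n μ γ ν t (fun j => Fin.rev (α j)) with hA
  have h1 : ∑ q : {j // j ∉ Finset.Icc a b} × Fin 2, ∑ p : {j // j ∈ Finset.Icc a b} × Fin 2,
        |A ((q.1 : Fin n), q.2) ((p.1 : Fin n), p.2)|
      = ∑ j ∈ (Finset.Icc a b)ᶜ, ∑ k ∈ Finset.Icc a b,
        ∑ s : Fin 2, ∑ s' : Fin 2, |A (j, s) (k, s')| := by
    rw [Fintype.sum_prod_type, Finset.sum_subtype (Finset.Icc a b)ᶜ (p := fun j => j ∉ Finset.Icc a b)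
      (fun j => Finset.mem_compl)]
    refine Finset.sum_congr rfl fun j _ => ?_
    rw [Finset.sum_comm (s := Finset.Icc a b)]
    refine Finset.sum_congr rfl fun s _ => ?_
    rw [Fintype.sum_prod_type,
      Finset.sum_subtype (Finset.Icc a b) (p := fun j => j ∈ Finset.Icc a b) (fun j => Iff.rfl)]
  rw [h1]
  exact Finset.sum_le_sum fun j _ => Finset.sum_le_sum fun k _ =>
    sum_abs_evolvedCovariance_le n μ γ ν t _ j k

/-! ### Uniform-in-time bounds on the propagator -/

theorem continuous_generator (n : ℕ) :
    Continuous fun θ : (ℕ → ℝ) × (ℕ → ℝ) × (ℕ → ℝ) => generator n θ.1 θ.2.1 θ.2.2 := by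
  refine continuous_matrix fun p q => ?_
  obtain ⟨j, s⟩ := p
  obtain ⟨k, t⟩ := q
  simp only [generator, Matrix.of_apply]
  split_ifs
  case neg => exact continuous_const
  all_goals fin_cases s <;> fin_cases t <;> simp <;> fun_prop

theorem continuous_propagator (n : ℕ) (t : ℝ) (l j : Fin n) :
    Continuous fun θ : (ℕ → ℝ) × (ℕ → ℝ) × (ℕ → ℝ) => propagator n θ.1 θ.2.1 θ.2.2 t l j := by
  have h : Continuous fun θ : (ℕ → ℝ) × (ℕ → ℝ) × (ℕ → ℝ) =>
      NormedSpace.exp (t • generator n θ.1 θ.2.1 θ.2.2) := by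
    open scoped Matrix.Norms.Operator in
    exact NormedSpace.exp_continuous.comp ((continuous_generator n).const_smul t)
  unfold propagator
  exact continuous_finsetSum _ fun s _ => continuous_finsetSum _ fun s' _ =>
    (h.matrix_elem (l, s) (j, s')).abs

/-- The supremum over time of the propagator. -/
def supPropagator (n : ℕ) (μ γ ν : ℕ → ℝ) (l j : Fin n) : ℝ≥0∞ :=
  ⨆ t : ℝ, ENNReal.ofReal (propagator n μ γ ν t l j)

theorem lowerSemicontinuous_supPropagator (n : ℕ) (l j : Fin n) :
    LowerSemicontinuous fun θ : (ℕ → ℝ) × (ℕ → ℝ) × (ℕ → ℝ) =>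
      supPropagator n θ.1 θ.2.1 θ.2.2 l j := by
  unfold supPropagator
  refine lowerSemicontinuous_iSup fun t => Continuous.lowerSemicontinuous ?_
  exact ENNReal.continuous_ofReal.comp (continuous_propagator n t l j)

theorem measurable_supPropagator {Ω : Type*} [MeasurableSpace Ω] {μ γ ν : ℕ → Ω → ℝ}
    (hμ : ∀ j, Measurable (μ j)) (hγ : ∀ j, Measurable (γ j)) (hν : ∀ j, Measurable (ν j))
    (n : ℕ) (l j : Fin n) :
    Measurable fun ω => supPropagator n (fun i => μ i ω) (fun i => γ i ω) (fun i => ν i ω) l j := by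
  have hm : Measurable fun ω => ((fun i => μ i ω, fun i => γ i ω, fun i => ν i ω) :
      (ℕ → ℝ) × (ℕ → ℝ) × (ℕ → ℝ)) :=
    (measurable_pi_lambda _ hμ).prodMk
      ((measurable_pi_lambda _ hγ).prodMk (measurable_pi_lambda _ hν))
  have h := (lowerSemicontinuous_supPropagator n l j).measurable.comp hm
  simpa only [Function.comp_def] using h

theorem propagator_nonneg (n : ℕ) (μ γ ν : ℕ → ℝ) (t : ℝ) (l j : Fin n) :
    0 ≤ propagator n μ γ ν t l j :=
  Finset.sum_nonneg fun _ _ => Finset.sum_nonneg fun _ _ => abs_nonneg _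

theorem supPropagator_le_four (n : ℕ) (μ γ ν : ℕ → ℝ) (l j : Fin n) :
    supPropagator n μ γ ν l j ≤ 4 := by
  refine iSup_le fun t => ?_
  rw [← ENNReal.ofReal_ofNat]
  refine ENNReal.ofReal_le_ofReal ?_
  have h := abs_apply_le_one_of_orthogonal (exp_generator_transpose_mul n μ γ ν t)
  refine (Finset.sum_le_sum fun s _ => Finset.sum_le_sum fun s' _ => h (l, s) (j, s')).trans ?_
  norm_num

theorem supPropagator_le_eigencorrelator (n : ℕ) (μ γ ν : ℕ → ℝ) (l j : Fin n) :
    supPropagator n μ γ ν l j ≤ 8 * eigencorrelator n μ γ ν l j := by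
  refine iSup_le fun t => ?_
  rw [propagator, ENNReal.ofReal_sum_of_nonneg fun _ _ => Finset.sum_nonneg fun _ _ => abs_nonneg _]
  simp only [ENNReal.ofReal_sum_of_nonneg fun _ _ => abs_nonneg _]
  refine (Finset.sum_le_sum fun s _ => Finset.sum_le_sum fun s' _ =>
    abs_exp_generator_le n μ γ ν t (l, s) (j, s')).trans (le_of_eq ?_)
  simp only [Finset.sum_const, Finset.card_univ, Fintype.card_fin, nsmul_eq_mul, ← mul_assoc]
  norm_num

theorem iSup_entanglement_le (n : ℕ) (μ γ ν : ℕ → ℝ) (a b : Fin n) :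
    ⨆ (t : ℝ) (α : Fin n → Fin 2), ENNReal.ofReal (entanglement (Finset.Icc a b)
        (evolve (hamiltonian n μ γ ν) t (pureState (upDown α))))
      ≤ 2 * ∑ j ∈ (Finset.Icc a b)ᶜ, ∑ k ∈ Finset.Icc a b, ∑ l,
          supPropagator n μ γ ν l j * supPropagator n μ γ ν l k := by
  refine iSup_le fun t => iSup_le fun α => ?_
  have hn := propagator_nonneg n μ γ ν t
  have h0 : ∀ j k, 0 ≤ ∑ l, propagator n μ γ ν t l j * propagator n μ γ ν t l k := fun j k =>
    Finset.sum_nonneg fun l _ => mul_nonneg (hn l j) (hn l k)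
  refine (ENNReal.ofReal_le_ofReal (entanglement_le_sum_propagator n μ γ ν t α a b)).trans ?_
  rw [ENNReal.ofReal_mul two_pos.le, ENNReal.ofReal_ofNat, ENNReal.ofReal_sum_of_nonneg
    fun j _ => Finset.sum_nonneg fun k _ => h0 j k]
  gcongr with j _
  rw [ENNReal.ofReal_sum_of_nonneg fun k _ => h0 j k]
  gcongr with k _
  rw [ENNReal.ofReal_sum_of_nonneg fun l _ => mul_nonneg (hn l j) (hn l k)]
  gcongr with l _
  rw [ENNReal.ofReal_mul (hn l j)]
  gcongr
  · exact le_iSup (fun t => ENNReal.ofReal (propagator n μ γ ν t l j)) t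
  · exact le_iSup (fun t => ENNReal.ofReal (propagator n μ γ ν t l k)) t

/-! ### Summation of polynomially decaying kernels -/

/-- The kernel `(1 + |x|)^{-s}` on the integers. -/
def decay (s : ℝ) (x : ℤ) : ℝ := (1 + |(x : ℝ)|) ^ (-s)

theorem decay_nonneg (s : ℝ) (x : ℤ) : 0 ≤ decay s x := by
  unfold decay; positivity

theorem decay_neg (s : ℝ) (x : ℤ) : decay s (-x) = decay s x := by
  simp [decay]

theorem summable_decay {s : ℝ} (hs : 1 < s) : Summable (decay s) := by
  have h : Summable fun m : ℕ => decay s m := by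
    have h1 := (Real.summable_nat_rpow (p := -s)).2 (by linarith)
    refine ((summable_nat_add_iff 1).2 h1).congr fun m => ?_
    simp [decay, abs_of_nonneg, add_comm]
  exact Summable.of_nat_of_neg h (by simpa only [decay_neg] using h)

theorem sum_decay_le {s : ℝ} (hs : 1 < s) {n : ℕ} (T : Finset (Fin n)) (l : ℤ) :
    ∑ k ∈ T, decay s (l - (k : ℕ)) ≤ ∑' x, decay s x := by
  have hinj : Set.InjOn (fun k : Fin n => l - ((k : ℕ) : ℤ)) T := by
    intro k _ k' _ h
    simp only at h
    ext
    omega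
  rw [← Finset.sum_image (f := decay s) hinj]
  exact (summable_decay hs).sum_le_tsum _ fun x _ => decay_nonneg s x

theorem decay_add_le {s : ℝ} (hs : 0 ≤ s) {x y : ℤ} (hx : 0 ≤ x) (hy : 0 ≤ y) :
    decay (2 * s) (x + y) ≤ decay s x * decay s y := by
  have hx' : (0 : ℝ) ≤ x := by exact_mod_cast hx
  have hy' : (0 : ℝ) ≤ y := by exact_mod_cast hy
  unfold decay
  push_cast
  rw [abs_of_nonneg hx', abs_of_nonneg hy', abs_of_nonneg (add_nonneg hx' hy'),
    ← Real.mul_rpow (by positivity) (by positivity), ← mul_neg, Real.rpow_mul (by positivity)]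
  refine Real.rpow_le_rpow_of_nonpos (by positivity) ?_ (by linarith)
  rw [Real.rpow_two]
  nlinarith [mul_nonneg hx' hy']

theorem sum_sum_decay_le {s : ℝ} (hs : 1 < s) {n : ℕ} (a b : Fin n) :
    ∑ j ∈ (Finset.Icc a b)ᶜ, ∑ k ∈ Finset.Icc a b, decay (2 * s) ((j : ℕ) - (k : ℕ))
      ≤ 2 * (∑' x, decay s x) ^ 2 := by
  have h1 : ∀ j ∈ (Finset.Icc a b)ᶜ, ∀ k ∈ Finset.Icc a b,
      decay (2 * s) ((j : ℕ) - (k : ℕ))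
        ≤ decay s ((a : ℕ) - (j : ℕ)) * decay s ((a : ℕ) - (k : ℕ))
          + decay s ((b : ℕ) - (j : ℕ)) * decay s ((b : ℕ) - (k : ℕ)) := by
    intro j hj k hk
    rw [Finset.mem_compl, Finset.mem_Icc, not_and_or, not_le, not_le] at hj
    rw [Finset.mem_Icc] at hk
    simp only [Fin.lt_def, Fin.le_def] at hj hk
    have hd := decay_nonneg s
    rcases hj with hj | hj
    · refine le_add_of_le_of_nonneg ?_ (mul_nonneg (hd _) (hd _))
      have := decay_add_le (s := s) (by linarith) (x := (a : ℕ) - (j : ℕ))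
        (y := (k : ℕ) - (a : ℕ)) (by omega) (by omega)
      rw [← decay_neg s ((k : ℕ) - (a : ℕ)), neg_sub, ← decay_neg] at this
      refine le_of_eq_of_le (congrArg (decay (2 * s)) ?_) this
      ring
    · refine le_add_of_nonneg_of_le (mul_nonneg (hd _) (hd _)) ?_
      have := decay_add_le (s := s) (by linarith) (x := (j : ℕ) - (b : ℕ))
        (y := (b : ℕ) - (k : ℕ)) (by omega) (by omega)
      rw [← decay_neg s ((j : ℕ) - (b : ℕ)), neg_sub] at this
      refine le_of_eq_of_le (congrArg (decay (2 * s)) ?_) this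
      ring
  refine (Finset.sum_le_sum fun j hj => Finset.sum_le_sum fun k hk => h1 j hj k hk).trans ?_
  simp only [Finset.sum_add_distrib, ← Finset.sum_mul_sum]
  have h2 : ∀ T : Finset (Fin n), ∀ l : ℤ, 0 ≤ ∑ k ∈ T, decay s (l - (k : ℕ)) := fun T l =>
    Finset.sum_nonneg fun k _ => decay_nonneg s _
  have h3 : 0 ≤ ∑' x, decay s x := tsum_nonneg (decay_nonneg s)
  have h4 := fun c : Fin n => mul_le_mul (sum_decay_le hs (Finset.Icc a b)ᶜ ((c : ℕ) : ℤ))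
    (sum_decay_le hs (Finset.Icc a b) ((c : ℕ) : ℤ)) (h2 _ _) h3
  linarith [h4 a, h4 b]

theorem sum_sum_sum_decay_le {s : ℝ} (hs : 1 < s) {n : ℕ} (a b : Fin n) :
    ∑ j ∈ (Finset.Icc a b)ᶜ, ∑ k ∈ Finset.Icc a b, ∑ l : Fin n,
        decay (2 * s) ((l : ℕ) - (j : ℕ)) * decay (2 * s) ((l : ℕ) - (k : ℕ))
      ≤ 4 * (∑' x, decay (2 * s) x) * (∑' x, decay s x) ^ 2 := by
  set S := Finset.Icc a b with hS
  set Z := ∑' x, decay (2 * s) x with hZ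
  set f : Fin n → Fin n → ℝ := fun l j => decay (2 * s) ((l : ℕ) - (j : ℕ)) with hf
  have hf0 : ∀ l j, 0 ≤ f l j := fun l j => decay_nonneg _ _
  have hsymm : ∀ l j, f l j = f j l := fun l j => by
    rw [hf]
    dsimp only
    rw [← decay_neg, neg_sub]
  have hsum : ∀ (T : Finset (Fin n)) l, ∑ k ∈ T, f l k ≤ Z := fun T l =>
    sum_decay_le (by linarith) T _
  have hbd : ∑ j ∈ Sᶜ, ∑ k ∈ S, f j k ≤ 2 * (∑' x, decay s x) ^ 2 := sum_sum_decay_le hs a b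
  have hZ0 : 0 ≤ Z := tsum_nonneg (decay_nonneg _)
  have h1 : ∑ j ∈ Sᶜ, ∑ k ∈ S, ∑ l, f l j * f l k
      = ∑ l, (∑ j ∈ Sᶜ, f l j) * ∑ k ∈ S, f l k := by
    rw [Finset.sum_congr rfl fun j _ => Finset.sum_comm, Finset.sum_comm]
    exact Finset.sum_congr rfl fun l _ => (Finset.sum_mul_sum _ _ _ _).symm
  rw [h1, ← Finset.sum_add_sum_compl S]
  have h2 : ∑ l ∈ S, (∑ j ∈ Sᶜ, f l j) * ∑ k ∈ S, f l k ≤ 2 * (∑' x, decay s x) ^ 2 * Z := by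
    refine (Finset.sum_le_sum fun l _ => mul_le_mul_of_nonneg_left (hsum S l)
      (Finset.sum_nonneg fun j _ => hf0 l j)).trans ?_
    rw [← Finset.sum_mul, Finset.sum_comm]
    refine mul_le_mul_of_nonneg_right (le_trans (le_of_eq ?_) hbd) hZ0
    exact Finset.sum_congr rfl fun j _ => Finset.sum_congr rfl fun l _ => hsymm l j
  have h3 : ∑ l ∈ Sᶜ, (∑ j ∈ Sᶜ, f l j) * ∑ k ∈ S, f l k ≤ Z * (2 * (∑' x, decay s x) ^ 2) := by
    refine (Finset.sum_le_sum fun l _ => mul_le_mul_of_nonneg_right (hsum Sᶜ l)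
      (Finset.sum_nonneg fun j _ => hf0 l j)).trans ?_
    rw [← Finset.mul_sum]
    exact mul_le_mul_of_nonneg_left hbd hZ0
  linarith

/-! ### Localization of the propagator -/

section random

variable {Ω : Type*} [MeasurableSpace Ω] {P : Measure Ω} {μ γ ν : ℕ → Ω → ℝ}

theorem lintegral_supPropagator_mul_le {C₀ β : ℝ} (hβ : 0 ≤ β)
    (hloc : EigencorrelatorLocalization P μ γ ν fun r => C₀ / (1 + r) ^ β)
    (n : ℕ) (l j k : Fin n) :
    ∫⁻ ω, supPropagator n (fun i => μ i ω) (fun i => γ i ω) (fun i => ν i ω) l j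
        * supPropagator n (fun i => μ i ω) (fun i => γ i ω) (fun i => ν i ω) l k ∂P
      ≤ ENNReal.ofReal (32 * C₀ *
        (decay (β / 2) ((l : ℕ) - (j : ℕ)) * decay (β / 2) ((l : ℕ) - (k : ℕ)))) := by
  have hC : 0 ≤ C₀ := by simpa using (hloc.pos 0 le_rfl).le
  set Y : Fin n → Fin n → Ω → ℝ≥0∞ := fun l j ω =>
    supPropagator n (fun i => μ i ω) (fun i => γ i ω) (fun i => ν i ω) l j with hY
  have h4 : ∀ l j ω, Y l j ω ≤ 4 := fun l j ω => supPropagator_le_four _ _ _ _ _ _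
  have hint : ∀ j, ∫⁻ ω, 4 * Y l j ω ∂P
      ≤ ENNReal.ofReal (32 * (C₀ / (1 + |((l : ℕ) : ℝ) - ((j : ℕ) : ℝ)|) ^ β)) := by
    intro j
    calc ∫⁻ ω, 4 * Y l j ω ∂P
        ≤ ∫⁻ ω, 32 * eigencorrelator n (fun i => μ i ω) (fun i => γ i ω) (fun i => ν i ω) l j ∂P := by
          refine lintegral_mono fun ω => ?_
          refine (mul_le_mul_right (supPropagator_le_eigencorrelator _ _ _ _ l j) 4).trans
            (le_of_eq ?_)
          rw [← mul_assoc]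
          norm_num
      _ = 32 * ∫⁻ ω, eigencorrelator n (fun i => μ i ω) (fun i => γ i ω) (fun i => ν i ω) l j ∂P :=
          lintegral_const_mul' _ _ (by norm_num)
      _ ≤ 32 * ENNReal.ofReal (C₀ / (1 + |((l : ℕ) : ℝ) - ((j : ℕ) : ℝ)|) ^ β) :=
          mul_le_mul_right (hloc.bound n l j) _
      _ = _ := by
          rw [ENNReal.ofReal_mul (by norm_num), ENNReal.ofReal_ofNat]
  have hdecay : ∀ j k : Fin n, |((l : ℕ) : ℝ) - ((k : ℕ) : ℝ)| ≤ |((l : ℕ) : ℝ) - ((j : ℕ) : ℝ)| →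
      32 * (C₀ / (1 + |((l : ℕ) : ℝ) - ((j : ℕ) : ℝ)|) ^ β)
        ≤ 32 * C₀ *
        (decay (β / 2) ((l : ℕ) - (j : ℕ)) * decay (β / 2) ((l : ℕ) - (k : ℕ))) := by
    intro j k h
    have h0 : 0 < 1 + |((l : ℕ) : ℝ) - ((j : ℕ) : ℝ)| := by positivity
    have h1 : decay (β / 2) ((l : ℕ) - (j : ℕ)) ≤ decay (β / 2) ((l : ℕ) - (k : ℕ)) := by
      unfold decay
      push_cast
      exact Real.rpow_le_rpow_of_nonpos (by positivity) (by linarith) (by linarith)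
    have h2 : ((1 + |((l : ℕ) : ℝ) - ((j : ℕ) : ℝ)|) ^ β)⁻¹
        = decay (β / 2) ((l : ℕ) - (j : ℕ)) * decay (β / 2) ((l : ℕ) - (j : ℕ)) := by
      unfold decay
      push_cast
      rw [← Real.rpow_add h0, ← Real.rpow_neg h0.le]
      congr 1
      ring
    rw [div_eq_mul_inv, h2, ← mul_assoc]
    gcongr
    exact decay_nonneg _ _
  rcases le_total |((l : ℕ) : ℝ) - ((k : ℕ) : ℝ)| |((l : ℕ) : ℝ) - ((j : ℕ) : ℝ)| with h | h
  · refine le_trans (lintegral_mono fun ω => ?_)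
      ((hint j).trans (ENNReal.ofReal_le_ofReal (hdecay j k h)))
    rw [mul_comm]
    exact mul_le_mul_left (h4 l k ω) _
  · rw [mul_comm (decay _ _)]
    refine le_trans (lintegral_mono fun ω => ?_)
      ((hint k).trans (ENNReal.ofReal_le_ofReal (hdecay k j h)))
    exact mul_le_mul_left (h4 l j ω) _

theorem lintegral_iSup_entanglement_le {C₀ β : ℝ} (hβ : 4 < β)
    (hmodel : IsRandomModel P μ γ ν)
    (hloc : EigencorrelatorLocalization P μ γ ν fun r => C₀ / (1 + r) ^ β)
    (n : ℕ) (a b : Fin n) :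
    ∫⁻ ω, (⨆ (t : ℝ) (α : Fin n → Fin 2), ENNReal.ofReal (entanglement (Finset.Icc a b)
        (evolve (hamiltonian n (fun j => μ j ω) (fun j => γ j ω) (fun j => ν j ω)) t
          (pureState (upDown α))))) ∂P
      ≤ ENNReal.ofReal (64 * C₀
        * (4 * (∑' x, decay (2 * (β / 4)) x) * (∑' x, decay (β / 4) x) ^ 2)) := by
  have hC : 0 ≤ C₀ := by simpa using (hloc.pos 0 le_rfl).le
  set Y : Fin n → Fin n → Ω → ℝ≥0∞ := fun l j ω =>
    supPropagator n (fun i => μ i ω) (fun i => γ i ω) (fun i => ν i ω) l j with hY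
  have hYm : ∀ l j, Measurable (Y l j) := fun l j =>
    measurable_supPropagator hmodel.measurable_μ hmodel.measurable_γ hmodel.measurable_ν n l j
  have hYYm : ∀ j k l, Measurable fun ω => Y l j ω * Y l k ω := fun j k l => (hYm l j).mul (hYm l k)
  set D : Fin n → Fin n → Fin n → ℝ := fun j k l =>
    decay (2 * (β / 4)) ((l : ℕ) - (j : ℕ)) * decay (2 * (β / 4)) ((l : ℕ) - (k : ℕ)) with hD
  have hD0 : ∀ j k l, 0 ≤ 32 * C₀ * D j k l := fun j k l =>
    mul_nonneg (by positivity) (mul_nonneg (decay_nonneg _ _) (decay_nonneg _ _))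
  have hE : ∀ j k l, ∫⁻ ω, Y l j ω * Y l k ω ∂P ≤ ENNReal.ofReal (32 * C₀ * D j k l) := by
    intro j k l
    have := lintegral_supPropagator_mul_le (by linarith) hloc n l j k
    rwa [show β / 2 = 2 * (β / 4) by ring] at this
  calc _ ≤ ∫⁻ ω, 2 * ∑ j ∈ (Finset.Icc a b)ᶜ, ∑ k ∈ Finset.Icc a b, ∑ l, Y l j ω * Y l k ω ∂P :=
        lintegral_mono fun ω => iSup_entanglement_le n _ _ _ a b
    _ = 2 * ∑ j ∈ (Finset.Icc a b)ᶜ, ∑ k ∈ Finset.Icc a b, ∑ l, ∫⁻ ω, Y l j ω * Y l k ω ∂P := by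
        rw [lintegral_const_mul' _ _ (by norm_num), lintegral_finsetSum _ fun j _ =>
          Finset.measurable_sum _ fun k _ => Finset.measurable_sum _ fun l _ => hYYm j k l]
        congr 1
        refine Finset.sum_congr rfl fun j _ => ?_
        rw [lintegral_finsetSum _ fun k _ => Finset.measurable_sum _ fun l _ => hYYm j k l]
        exact Finset.sum_congr rfl fun k _ => lintegral_finsetSum _ fun l _ => hYYm j k l
    _ ≤ 2 * ∑ j ∈ (Finset.Icc a b)ᶜ, ∑ k ∈ Finset.Icc a b, ∑ l,
          ENNReal.ofReal (32 * C₀ * D j k l) := by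
        gcongr with j _ k _ l _
        exact hE j k l
    _ = ENNReal.ofReal (2 * ∑ j ∈ (Finset.Icc a b)ᶜ, ∑ k ∈ Finset.Icc a b, ∑ l,
          32 * C₀ * D j k l) := by
        rw [ENNReal.ofReal_mul two_pos.le, ENNReal.ofReal_ofNat, ENNReal.ofReal_sum_of_nonneg
          fun j _ => Finset.sum_nonneg fun k _ => Finset.sum_nonneg fun l _ => hD0 j k l]
        congr 1
        refine Finset.sum_congr rfl fun j _ => ?_
        rw [ENNReal.ofReal_sum_of_nonneg fun k _ => Finset.sum_nonneg fun l _ => hD0 j k l]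
        exact Finset.sum_congr rfl fun k _ =>
          (ENNReal.ofReal_sum_of_nonneg fun l _ => hD0 j k l).symm
    _ ≤ _ := by
        refine ENNReal.ofReal_le_ofReal ?_
        simp only [← Finset.mul_sum]
        have := mul_le_mul_of_nonneg_left (sum_sum_sum_decay_le (s := β / 4) (by linarith) a b)
          (show 0 ≤ 64 * C₀ by positivity)
        linarith

end random

end XYChain

end

theorem corollary1p3 {Ω : Type*} [MeasurableSpace Ω] (P : Measure Ω) [IsProbabilityMeasure P]
    (μ γ ν : ℕ → Ω → ℝ) (hmodel : XYChain.IsRandomModel P μ γ ν)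
    (hsimple : XYChain.AlmostSurelySimple P μ γ ν)
    (C₀ β : ℝ) (hβ : 4 < β)
    (hloc : XYChain.EigencorrelatorLocalization P μ γ ν (fun r => C₀ / (1 + r) ^ β)) :
    ∃ C : ℝ, ∀ (n : ℕ) (a b : Fin n), a ≤ b →
      ∫⁻ ω, (⨆ (t : ℝ) (α : Fin n → Fin 2),
          ENNReal.ofReal (XYChain.entanglement (Finset.Icc a b)
            (XYChain.evolve
              (XYChain.hamiltonian n (fun j => μ j ω) (fun j => γ j ω) (fun j => ν j ω)) t
              (XYChain.pureState (XYChain.upDown α))))) ∂P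
        ≤ ENNReal.ofReal C := by
  exact ⟨_, fun n a b _ => XYChain.lintegral_iSup_entanglement_le hβ hmodel hloc n a b⟩
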